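/- There exist a real number $R>0$ and three smooth ($C^\infty$) embedded surfaces with boundary $S_+,S_-,S_0\subset\mathbb R^3$ having as common boundary the circle $\Gamma=\{z=0,\ x^2+y^2=R^2\}$, such that the following hold. 1. (Lens shape.) $S_+$ is homeomorphic to the closed disc (in particular bounded), and $S_+\setminus\Gamma$ lies in $\{z>0\}$; $S_-$ is the reflection of $S_+$ through the horizontal plane $\{z=0\}$; and $S_0=\{z=0,\ x^2+y^2\ge R^2\}$ is the unbounded part of that plane outside $\Gamma$. Any two of the three surfaces intersect exactly in $\Gamma$. 2. (Symmetry.) Each of the three surfaces is invariant under all rotations about the vertical axis, and the cluster $S_+\cup S_-\cup S_0$ is invariant under reflection through the horizontal plane. 3. (Angles.) At every point of $\Gamma$ the inward unit conormals of the three surfaces form pairwise angles of $120$ degrees. 4. (Self-shrinker.) At every point $x$ of each of the three surfaces (up to the boundary) one has $\overline{\mathrm H}+x^\perp=0$, where $\overline{\mathrm H}$ is the mean curvature vector of the surface and $x^\perp$ is the component of the position vector $x$ normal to the surface. Moreover, the homothetically shrinking family of clusters $\sqrt{1-2t}\,(S_+,S_-,S_0)$, $t<1/2$, moves by mean curvature,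 i.e. the normal velocity of each surface equals its mean curvature vector, the three surfaces meeting at angles of $120$ degrees along the common circle $\sqrt{1-2t}\,\Gamma$ at all times. -/

import Mathlib

open Set Topology
open scoped ContDiff Pointwise RealInnerProductSpace

noncomputable section

/-- The Euclidean space `ℝ³`; the coordinate of index `2` is the height. -/
abbrev E3 := EuclideanSpace ℝ (Fin 3)

/-- The parameter plane `ℝ²`. -/
abbrev E2 := EuclideanSpace ℝ (Fin 2)

/-- The closed half-plane on which surfaces with boundary are parametrized. -/
def halfPlane : Set E2 := {w | 0 ≤ w 0}

/-! ### Differential geometry of a parametrized surface -/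

/-- The partial derivative `∂ᵢ X` at `w`. -/
def partialD (X : E2 → E3) (i : Fin 2) (w : E2) : E3 :=
  fderiv ℝ X w (EuclideanSpace.single i 1)

/-- The tangent plane at `X w` of the surface parametrized by `X`. -/
def tangentPlane (X : E2 → E3) (w : E2) : Submodule ℝ E3 :=
  LinearMap.range (fderiv ℝ X w).toLinearMap

/-- The component `v^⊥` of `v` normal to the surface parametrized by `X`, at the point `X w`. -/
def normalPart (X : E2 → E3) (w : E2) (v : E3) : E3 :=
  (tangentPlane X w)ᗮ.starProjection v

/-- The first fundamental form `g i j = ⟪∂ᵢ X, ∂ⱼ X⟫`. -/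
def firstFundamentalForm (X : E2 → E3) (w : E2) : Matrix (Fin 2) (Fin 2) ℝ :=
  Matrix.of fun i j => ⟪partialD X i w, partialD X j w⟫

/-- The mean curvature vector at `X w`: the trace, with respect to the first fundamental form, of
the vector-valued second fundamental form `(∂ᵢ ∂ⱼ X)^⊥`. (For the sphere of radius `r` it is
`-(2 / r ^ 2) • x`.) -/
def meanCurvatureVector (X : E2 → E3) (w : E2) : E3 :=
  ∑ i, ∑ j, ((firstFundamentalForm X w)⁻¹ i j) • normalPart X w (partialD (partialD X j) i w)

/-! ### Smooth embedded surfaces with boundary -/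

/-- `X`, defined on the open set `W ⊆ ℝ²`, is a smooth local parametrization of the surface `S`
with boundary `Γ`: a smooth immersion of `W` whose restriction to `W ∩ halfPlane` is a
homeomorphism onto a relatively open piece of `S`, the points of `Γ` in that piece being the ones
with parameter on the line `w 0 = 0`. Interior points are covered by sets `W` contained in the open
half-plane. -/
structure IsLocalParam (S Γ : Set E3) (X : E2 → E3) (W : Set E2) : Prop where
  isOpen : IsOpen W
  smooth : ContDiffOn ℝ ∞ X W
  immersion : ∀ w ∈ W, Function.Injective (fderiv ℝ X w)
  embedding : IsEmbedding (fun w : ↥(W ∩ halfPlane) => X w)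
  image : ∃ U : Set E3, IsOpen U ∧ X '' (W ∩ halfPlane) = S ∩ U
  boundary : ∀ w ∈ W ∩ halfPlane, X w ∈ Γ ↔ w 0 = 0

/-- `S` is a smooth embedded surface in `ℝ³` with boundary `Γ` (contained in `S`). -/
def IsSurfaceWithBoundary (S Γ : Set E3) : Prop :=
  Γ ⊆ S ∧ ∀ p ∈ S, ∃ X W, IsLocalParam S Γ X W ∧ ∃ w ∈ W ∩ halfPlane, X w = p

/-- `η` is the inward unit conormal of the surface `S` at its boundary point `p ∈ Γ`: the unit
vector tangent to `S`, orthogonal to the boundary curve, pointing into `S`. -/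
def IsInwardConormal (S Γ : Set E3) (p η : E3) : Prop :=
  ∃ X W, IsLocalParam S Γ X W ∧ ∃ w ∈ W, w 0 = 0 ∧ X w = p ∧
    ‖η‖ = 1 ∧ η ∈ tangentPlane X w ∧ ⟪η, partialD X 1 w⟫ = 0 ∧ 0 < ⟪η, partialD X 0 w⟫

/-- The shrinker equation `H + x^⊥ = 0` at every point of the surface `S` (with boundary `Γ`).
Neither `H` nor `x^⊥` depends on the local parametrization used to compute it. -/
def ShrinkerEquation (S Γ : Set E3) : Prop :=
  ∀ p ∈ S, ∃ X W, IsLocalParam S Γ X W ∧ ∃ w ∈ W ∩ halfPlane, X w = p ∧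
    meanCurvatureVector X w + normalPart X w p = 0

/-! ### Clusters of three surfaces and their motion by mean curvature -/

/-- Three smooth embedded surfaces having the common boundary `Γ`, disjoint away from `Γ`, and
forming along `Γ` three angles of 120 degrees. -/
structure IsTripleCluster (S : Fin 3 → Set E3) (Γ : Set E3) : Prop where
  surface : ∀ i, IsSurfaceWithBoundary (S i) Γ
  meet : ∀ i j, i ≠ j → S i ∩ S j = Γ
  angle : ∀ p ∈ Γ, ∃ η : Fin 3 → E3, (∀ i, IsInwardConormal (S i) Γ p (η i)) ∧
    ∀ i j, i ≠ j → InnerProductGeometry.angle (η i) (η j) = 2 * Real.pi / 3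

/-- The surfaces `S t` with boundaries `Γ t`, for `t` in the open interval `I`, move smoothly with
normal velocity equal to the mean curvature vector: near each time and point they have local
parametrizations depending smoothly on time, whose velocity has normal component `H`. -/
def MovesByMeanCurvature (S Γ : ℝ → Set E3) (I : Set ℝ) : Prop :=
  ∀ t₀ ∈ I, ∀ p ∈ S t₀, ∃ (J : Set ℝ) (W : Set E2) (X : ℝ → E2 → E3),
    IsOpen J ∧ t₀ ∈ J ∧ J ⊆ I ∧
    ContDiffOn ℝ ∞ (fun q : ℝ × E2 => X q.1 q.2) (J ×ˢ W) ∧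
    (∀ t ∈ J, IsLocalParam (S t) (Γ t) (X t) W) ∧
    (∃ w ∈ W ∩ halfPlane, X t₀ w = p) ∧
    ∀ t ∈ J, ∀ w ∈ W ∩ halfPlane,
      normalPart (X t) w (deriv (fun τ => X τ w) t) = meanCurvatureVector (X t) w

/-- Mean curvature flow, on the open time interval `I`, of a cluster of three surfaces meeting along
a common boundary at angles of 120 degrees. -/
def IsClusterFlow (S : ℝ → Fin 3 → Set E3) (Γ : ℝ → Set E3) (I : Set ℝ) : Prop :=
  (∀ t ∈ I, IsTripleCluster (S t) (Γ t)) ∧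
    ∀ i, MovesByMeanCurvature (fun t => S t i) Γ I

/-- The cluster is a self-shrinker: the homothetic family `√(1 - 2t) S`, `t < 1/2`, which is `S` at
time `0` and shrinks to the origin as `t → 1/2`, is a mean curvature flow. The factor is the one
corresponding to the normalization `H + x^⊥ = 0`. -/
def IsSelfShrinker (S : Fin 3 → Set E3) (Γ : Set E3) : Prop :=
  IsClusterFlow (fun t i => √(1 - 2 * t) • S i) (fun t => √(1 - 2 * t) • Γ) (Iio (1 / 2))

/-! ### Symmetries and the horizontal plane -/

/-- The rotation of angle `θ` about the vertical axis. -/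
def rotateVertical (θ : ℝ) (p : E3) : E3 :=
  !₂[Real.cos θ * p 0 - Real.sin θ * p 1, Real.sin θ * p 0 + Real.cos θ * p 1, p 2]

/-- The reflection through the horizontal plane. -/
def reflectHorizontal (p : E3) : E3 := !₂[p 0, p 1, -p 2]

/-- The circle of radius `R` about the origin in the horizontal plane. -/
def horizontalCircle (R : ℝ) : Set E3 := {p | p 2 = 0 ∧ p 0 ^ 2 + p 1 ^ 2 = R ^ 2}

/-- The unbounded part of the horizontal plane outside the circle of radius `R`. -/
def outerPlane (R : ℝ) : Set E3 := {p | p 2 = 0 ∧ R ^ 2 ≤ p 0 ^ 2 + p 1 ^ 2}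

/-- The cluster `S` is lens-shaped, with edge the horizontal circle of radius `R`: `S 0` is a closed
topological disc (hence bounded) lying above the horizontal plane except for that circle, `S 1` is
its reflection through the plane, and `S 2` is the part of the plane outside the circle. -/
structure IsLensShaped (S : Fin 3 → Set E3) (R : ℝ) : Prop where
  pos : 0 < R
  disc : Nonempty (S 0 ≃ₜ Metric.closedBall (0 : E2) 1)
  above : ∀ p ∈ S 0 \ horizontalCircle R, 0 < p 2
  reflect : S 1 = reflectHorizontal '' S 0
  outer : S 2 = outerPlane R

end

/-!
The cluster is found by shooting. A rotationally symmetric graph `z = V(s)`, `s = r² / 2`, satisfies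
`H + x^⊥ = 0` exactly when `2 s V'' + V' + (V + V' - 2 s V') (1 + 2 s V'²) = 0`
(`ProfileEquation`), and the caps `z = ±V` meet the outer plane at 120 degrees when the slope
`r V'` is `-√3` at the first zero of `V`. The equation is odd in `V` and solved by `V = 0`, so the
reflected cap and the plane need no separate treatment.

Write `V = √ε v` with `v(0) = 1` and `w = v'`. The initial value problem is singular at `s = 0`. With
the nonlinearity `K` cut off to a compactly supported function it becomes the fixed-point problem
`v(s) = 1 + s ∫₀¹ w(τ s) dτ`, `w(s) = ∫₀¹ (-v(τ s) / 2 + τ s K) dτ`, a contraction in an exponentially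
weighted sup norm (`norm_shootOp_sub_le`), with a fixed point depending continuously on `ε`; a bootstrap shows
that it is smooth across `s = 0` (`exists_smooth_solution`).

As long as `v > 0` and the squared slope `2 s ε w²` is below `3`, the cutoff is inactive
(`TruncatedSolution.cutoff_eventually_eq_one`) and `w' ≤ 0` (`TruncatedSolution.deriv_w_nonpos`).
Hence `w ≤ -1 / 2` and `v ≤ 1 - s / 2`, so one of the two conditions fails at some `s ≤ 2`. For
`ε = 0` the slope is zero and `v` vanishes first. For `ε = 4` the slope reaches the threshold first,
since concavity forces `2 s ε w² ≥ ε` at a zero of `v`. Each alternative holds on an open set of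
parameters, because a trajectory reaching only one of the thresholds crosses it with nonzero speed.
By connectedness of `[0, 4]` the two conditions fail simultaneously for some `ε`
(`exists_critical_parameter`), and that `ε` gives the profile (`exists_profile`).

The geometric part covers each surface by charts satisfying the shrinker equation
(`exists_shrinkerChart`): horizontal coordinates away from the circle, which include the pole, and
polar coordinates along the circle. The flow consists of the homothetic images of these charts
(`movesByMeanCurvature_of_shrinker`).
-/

/-! ### A singular integral equation -/

/-- The integrand of the fixed-point equation: for `y = (v, w)` it is the pair
`(s w, -v / 2 + τ s K(ε, τ s, v, w))`. -/
noncomputable def shootIntegrand (K : ℝ × ℝ × ℝ × ℝ → ℝ) (ε s τ : ℝ) (y : ℝ × ℝ) : ℝ × ℝ :=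
  (s * y.2, -y.1 / 2 + τ * s * K (ε, τ * s, y.1, y.2))

theorem continuous_shootIntegrand {K : ℝ × ℝ × ℝ × ℝ → ℝ} (hK : Continuous K) (ε : ℝ) {Y : ℝ → ℝ × ℝ}
    (hY : Continuous Y) :
    Continuous fun q : ℝ × ℝ => shootIntegrand K ε q.1 q.2 (Y (q.2 * q.1)) := by
  unfold shootIntegrand
  fun_prop

theorem norm_shootIntegrand_sub_le {K : ℝ × ℝ × ℝ × ℝ → ℝ} {L : NNReal} (hK : LipschitzWith L K)
    (ε ε' s τ : ℝ) (hτ : τ ∈ Icc (0 : ℝ) 1) (y y' : ℝ × ℝ) :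
    ‖shootIntegrand K ε s τ y - shootIntegrand K ε' s τ y'‖ ≤
      (1 / 2 + (L + 1) * |s|) * ‖y - y'‖ + L * |s| * |ε - ε'| := by
  have h1 : |y.1 - y'.1| ≤ ‖y - y'‖ := norm_fst_le (y - y')
  have h2 : |y.2 - y'.2| ≤ ‖y - y'‖ := norm_snd_le (y - y')
  have hL : (0 : ℝ) ≤ L := L.2
  have hs := abs_nonneg s
  have he := abs_nonneg (ε - ε')
  have hy := norm_nonneg (y - y')
  have hd : |K (ε, τ * s, y.1, y.2) - K (ε', τ * s, y'.1, y'.2)| ≤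
      L * (|ε - ε'| + ‖y - y'‖) := by
    have := hK.dist_le_mul (ε, τ * s, y.1, y.2) (ε', τ * s, y'.1, y'.2)
    rw [Real.dist_eq] at this
    refine this.trans (mul_le_mul_of_nonneg_left ?_ hL)
    rw [Prod.dist_eq, Prod.dist_eq, Prod.dist_eq]
    simp only [Real.dist_eq, sub_self, abs_zero]
    refine max_le (by linarith) (max_le (by linarith) (max_le (by linarith) (by linarith)))
  have hτs : |τ * s| ≤ |s| := by
    rw [abs_mul, abs_of_nonneg hτ.1]
    nlinarith [hτ.2]
  have hLs : 0 ≤ L * |s| := mul_nonneg hL hs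
  refine (Prod.norm_def _).trans_le (max_le ?_ ?_)
  · simp only [shootIntegrand, Prod.fst_sub, ← mul_sub, Real.norm_eq_abs, abs_mul]
    nlinarith [mul_le_mul_of_nonneg_left h2 hs, mul_nonneg hLs he, mul_nonneg hLs hy]
  · simp only [shootIntegrand, Prod.snd_sub, Real.norm_eq_abs]
    have : -y.1 / 2 + τ * s * K (ε, τ * s, y.1, y.2) -
        (-y'.1 / 2 + τ * s * K (ε', τ * s, y'.1, y'.2)) = -(y.1 - y'.1) / 2 +
        τ * s * (K (ε, τ * s, y.1, y.2) - K (ε', τ * s, y'.1, y'.2)) := by ring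
    rw [this]
    refine (abs_add_le _ _).trans ?_
    rw [abs_mul (τ * s), abs_div, abs_neg, abs_two]
    have := mul_le_mul hτs hd (abs_nonneg _) hs
    nlinarith [mul_nonneg hs hy]

theorem integral_exp_weight_le {a b l : ℝ} (ha : 0 ≤ a) (hb : 0 ≤ b) (hl : 0 < l) (s : ℝ) :
    ∫ τ in (0 : ℝ)..1, (a + b * |s|) * Real.exp (l * |τ * s|) ≤
      (a + b / l) * Real.exp (l * |s|) := by
  have hE : ∀ τ ∈ Icc (0 : ℝ) 1, l * |τ * s| = l * |s| * τ := fun τ hτ => by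
    rw [abs_mul, abs_of_nonneg hτ.1]; ring
  have h1 : ∫ τ in (0 : ℝ)..1, b * |s| * Real.exp (l * |s| * τ) ≤ b / l * Real.exp (l * |s|) := by
    have hd : ∀ τ ∈ uIcc (0 : ℝ) 1, HasDerivAt (fun τ => b / l * Real.exp (l * |s| * τ))
        (b * |s| * Real.exp (l * |s| * τ)) τ := fun τ _ => by
      have := (((hasDerivAt_id τ).const_mul (l * |s|)).exp).const_mul (b / l)
      refine this.congr_deriv ?_
      simp only [id]
      field_simp
    rw [intervalIntegral.integral_eq_sub_of_hasDerivAt hd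
      ((by fun_prop : Continuous _).intervalIntegrable _ _)]
    have : 0 ≤ b / l := by positivity
    simp [this]
  have h2 : ∫ τ in (0 : ℝ)..1, a * Real.exp (l * |s| * τ) ≤ a * Real.exp (l * |s|) := by
    have : ∫ τ in (0 : ℝ)..1, a * Real.exp (l * |s|) = a * Real.exp (l * |s|) := by simp
    rw [← this]
    refine intervalIntegral.integral_mono_on zero_le_one
      ((by fun_prop : Continuous _).intervalIntegrable _ _) (by simp) fun τ hτ => ?_
    refine mul_le_mul_of_nonneg_left (Real.exp_le_exp.2 ?_) ha
    have := mul_nonneg hl.le (abs_nonneg s)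
    nlinarith [hτ.2]
  calc _ = ∫ τ in (0 : ℝ)..1, (a * Real.exp (l * |s| * τ) + b * |s| * Real.exp (l * |s| * τ)) := by
        refine intervalIntegral.integral_congr fun τ hτ => ?_
        rw [uIcc_of_le zero_le_one] at hτ
        simp only [hE τ hτ]; ring
    _ = _ := intervalIntegral.integral_add ((by fun_prop : Continuous _).intervalIntegrable _ _)
        ((by fun_prop : Continuous _).intervalIntegrable _ _)
    _ ≤ _ := by linarith

/-- The integral operator of the shooting problem. -/
noncomputable def shootOp (K : ℝ × ℝ × ℝ × ℝ → ℝ) (ε : ℝ) (Y : ℝ → ℝ × ℝ) (s : ℝ) : ℝ × ℝ :=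
  (1, 0) + ∫ τ in (0 : ℝ)..1, shootIntegrand K ε s τ (Y (τ * s))

theorem continuous_shootOp {K : ℝ × ℝ × ℝ × ℝ → ℝ} (hK : Continuous K) (ε : ℝ) {Y : ℝ → ℝ × ℝ}
    (hY : Continuous Y) : Continuous (shootOp K ε Y) :=
  continuous_const.add <| intervalIntegral.continuous_parametric_intervalIntegral_of_continuous'
    (continuous_shootIntegrand hK ε hY) 0 1

/-- In the norm with weight `exp (-l |s|)`, `l = 4 (L + 1)`, the operator `shootOp` is a contraction
of ratio `3 / 4` and depends on `ε` in a Lipschitz way. The ratio is `1 / 2 + (L + 1) / l`: the term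
`-v / 2` of the integrand, which carries no factor `s`, contributes the `1 / 2`. -/
theorem norm_shootOp_sub_le {K : ℝ × ℝ × ℝ × ℝ → ℝ} {L : NNReal} (hK : LipschitzWith L K)
    (ε ε' : ℝ) {Y Y' : ℝ → ℝ × ℝ} (hY : Continuous Y) (hY' : Continuous Y') {D : ℝ} (hD : 0 ≤ D)
    (h : ∀ s, ‖Y s - Y' s‖ ≤ D * Real.exp (4 * (L + 1) * |s|)) (s : ℝ) :
    ‖shootOp K ε Y s - shootOp K ε' Y' s‖ ≤
      (3 / 4 * D + L * |ε - ε'|) * Real.exp (4 * (L + 1) * |s|) := by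
  have hL : (0 : ℝ) ≤ L := L.2
  have c1 := continuous_shootIntegrand hK.continuous ε hY
  have c2 := continuous_shootIntegrand hK.continuous ε' hY'
  have e1 : shootOp K ε Y s - shootOp K ε' Y' s = ∫ τ in (0 : ℝ)..1,
      (shootIntegrand K ε s τ (Y (τ * s)) - shootIntegrand K ε' s τ (Y' (τ * s))) := by
    rw [intervalIntegral.integral_sub]
    · simp [shootOp]
    · exact (c1.comp (by fun_prop : Continuous fun τ : ℝ => (s, τ))).intervalIntegrable _ _
    · exact (c2.comp (by fun_prop : Continuous fun τ : ℝ => (s, τ))).intervalIntegrable _ _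
  rw [e1]
  have hexp : |s| ≤ Real.exp (4 * (L + 1) * |s|) := by
    have := Real.add_one_le_exp (4 * (L + 1) * |s|)
    nlinarith [abs_nonneg s, mul_nonneg hL (abs_nonneg s)]
  calc _ ≤ ∫ τ in (0 : ℝ)..1, (((1 / 2) * D + (L + 1) * D * |s|) * Real.exp (4 * (L + 1) * |τ * s|)
          + L * |s| * |ε - ε'|) := by
        refine intervalIntegral.norm_integral_le_of_norm_le zero_le_one
          (Filter.Eventually.of_forall fun τ hτ => ?_)
          ((by fun_prop : Continuous _).intervalIntegrable _ _)
        refine (norm_shootIntegrand_sub_le hK ε ε' s τ ⟨hτ.1.le, hτ.2⟩ _ _).trans ?_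
        have := mul_le_mul_of_nonneg_left (h (τ * s))
          (by positivity : 0 ≤ 1 / 2 + (L + 1) * |s|)
        linarith
    _ = (∫ τ in (0 : ℝ)..1,
          ((1 / 2) * D + (L + 1) * D * |s|) * Real.exp (4 * (L + 1) * |τ * s|))
          + L * |s| * |ε - ε'| := by
        rw [intervalIntegral.integral_add ((by fun_prop : Continuous _).intervalIntegrable _ _)
          (by simp)]
        simp
    _ ≤ (1 / 2 * D + (L + 1) * D / (4 * (L + 1))) * Real.exp (4 * (L + 1) * |s|)
          + L * Real.exp (4 * (L + 1) * |s|) * |ε - ε'| := by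
        gcongr
        exact integral_exp_weight_le (by positivity) (by positivity) (by positivity) s
    _ = _ := by
        have : (L + 1) * D / (4 * (L + 1)) = D / 4 := by field_simp
        rw [this]; ring

theorem norm_shootOp_zero_le {K : ℝ × ℝ × ℝ × ℝ → ℝ} {L : NNReal} {C : ℝ}
    (hC : ∀ q, |K q| ≤ C) (ε s : ℝ) :
    ‖shootOp K ε 0 s‖ ≤ (1 + C) * Real.exp (4 * (L + 1) * |s|) := by
  have hL : (0 : ℝ) ≤ L := L.2
  have hC0 : 0 ≤ C := (abs_nonneg _).trans (hC 0)
  have hexp := Real.add_one_le_exp (4 * (L + 1) * |s|)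
  have hLs := mul_nonneg hL (abs_nonneg s)
  have hs := abs_nonneg s
  have : ‖∫ τ in (0 : ℝ)..1, shootIntegrand K ε s τ 0‖ ≤ C * |s| * |1 - 0| := by
    refine intervalIntegral.norm_integral_le_of_norm_le_const fun τ hτ => ?_
    rw [uIoc_of_le zero_le_one] at hτ
    have h1 : |τ * s| ≤ |s| := by
      rw [abs_mul, abs_of_nonneg hτ.1.le]
      nlinarith [hτ.2]
    simp only [shootIntegrand, Prod.norm_def, Prod.fst_zero, Prod.snd_zero, mul_zero, neg_zero,
      zero_div, zero_add, norm_zero, Real.norm_eq_abs]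
    refine max_le (by positivity) ?_
    rw [abs_mul, mul_comm]
    exact mul_le_mul (hC _) h1 (abs_nonneg _) hC0
  refine (norm_add_le _ _).trans ?_
  have h1 : ‖((1 : ℝ), (0 : ℝ))‖ = 1 := by simp [Prod.norm_def]
  rw [h1]
  simp only [Pi.zero_apply]
  norm_num at this
  nlinarith [mul_le_mul_of_nonneg_left hexp hC0, mul_nonneg hC0 hLs, mul_nonneg hC0 hs]

/-- For bounded Lipschitz `K` the singular system `(s w)' = -v / 2 + s K(ε, s, v, w)`, `v' = w`,
`v 0 = 1`, in integrated form, has a solution on the whole line that is jointly continuous in the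
parameter `ε` and the variable `s`. -/
theorem exists_shootOp_fixed {K : ℝ × ℝ × ℝ × ℝ → ℝ} {L : NNReal} (hK : LipschitzWith L K) {C : ℝ}
    (hC : ∀ q, |K q| ≤ C) :
    ∃ Y : ℝ → ℝ → ℝ × ℝ, (Continuous fun q : ℝ × ℝ => Y q.1 q.2) ∧
      ∀ ε s, Y ε s = shootOp K ε (Y ε) s := by
  have hL : (0 : ℝ) ≤ L := L.2
  set E : ℝ → ℝ := fun s => Real.exp (4 * (L + 1) * |s|) with hE
  have hEc : Continuous E := by fun_prop
  have hE0 : ∀ s, 0 < E s := fun s => Real.exp_pos _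
  let T : BoundedContinuousFunction ℝ (ℝ × ℝ) → ℝ → ℝ × ℝ := fun g s => E s • g s
  have hT : ∀ g, Continuous (T g) := fun g => hEc.smul g.continuous
  have hTd : ∀ g g' s, ‖T g s - T g' s‖ ≤ dist g g' * E s := fun g g' s => by
    simp only [T, ← smul_sub, norm_smul, Real.norm_eq_abs, abs_of_pos (hE0 s)]
    rw [mul_comm, ← dist_eq_norm]
    exact mul_le_mul_of_nonneg_right (g.dist_coe_le_dist s) (hE0 s).le
  have hbd : ∀ ε g s, ‖(E s)⁻¹ • shootOp K ε (T g) s‖ ≤ 3 / 4 * ‖g‖ + (1 + C) := fun ε g s => by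
    rw [norm_smul, norm_inv, Real.norm_eq_abs, abs_of_pos (hE0 s), inv_mul_le_iff₀ (hE0 s)]
    have h1 := norm_shootOp_sub_le hK ε ε (hT g) continuous_zero (norm_nonneg g) (fun s => by
      simpa [T] using hTd g 0 s) s
    have h2 := norm_shootOp_zero_le (L := L) hC ε s
    have h3 := norm_add_le (shootOp K ε (T g) s - shootOp K ε 0 s) (shootOp K ε 0 s)
    simp only [sub_add_cancel, sub_self, abs_zero, mul_zero, add_zero] at h1 h3
    change _ ≤ E s * _
    change _ ≤ 3 / 4 * ‖g‖ * E s at h1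
    change _ ≤ (1 + C) * E s at h2
    change ‖shootOp K ε (T g) s - shootOp K ε 0 s‖ ≤ _ at h1
    linarith
  let Ψ : ℝ → BoundedContinuousFunction ℝ (ℝ × ℝ) → BoundedContinuousFunction ℝ (ℝ × ℝ) :=
    fun ε g => BoundedContinuousFunction.ofNormedAddCommGroup
      (fun s => (E s)⁻¹ • shootOp K ε (T g) s)
      ((hEc.inv₀ fun s => (hE0 s).ne').smul (continuous_shootOp hK.continuous ε (hT g)))
      _ (hbd ε g)
  have hΨ : ∀ ε ε' g g', dist (Ψ ε g) (Ψ ε' g') ≤ 3 / 4 * dist g g' + L * |ε - ε'| := by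
    intro ε ε' g g'
    refine (BoundedContinuousFunction.dist_le (by positivity)).2 fun s => ?_
    simp only [Ψ, BoundedContinuousFunction.coe_ofNormedAddCommGroup]
    rw [dist_eq_norm, ← smul_sub, norm_smul, norm_inv, Real.norm_eq_abs, abs_of_pos (hE0 s),
      inv_mul_le_iff₀ (hE0 s), mul_comm]
    exact norm_shootOp_sub_le hK ε ε' (hT g) (hT g') dist_nonneg (hTd g g') s
  have hcontr : ∀ ε, ContractingWith (3 / 4 : NNReal) (Ψ ε) := fun ε =>
    ⟨by rw [div_lt_one (by norm_num)]; norm_num, LipschitzWith.of_dist_le_mul fun g g' => by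
      simpa using hΨ ε ε g g'⟩
  let F : ℝ → BoundedContinuousFunction ℝ (ℝ × ℝ) := fun ε =>
    ContractingWith.fixedPoint (Ψ ε) (hcontr ε)
  have hF : ∀ ε, Ψ ε (F ε) = F ε := fun ε => (hcontr ε).fixedPoint_isFixedPt
  have hFd : ∀ ε ε', dist (F ε) (F ε') ≤ 4 * L * dist ε ε' := fun ε ε' => by
    have := hΨ ε ε' (F ε) (F ε')
    rw [hF, hF] at this
    rw [Real.dist_eq]
    linarith
  have hFc : Continuous F := (LipschitzWith.of_dist_le_mul (K := 4 * L) fun ε ε' => by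
    simpa using hFd ε ε').continuous
  refine ⟨fun ε => T (F ε), ?_, fun ε s => ?_⟩
  · refine (hEc.comp continuous_snd).smul ?_
    have := (continuous_eval (F := BoundedContinuousFunction ℝ (ℝ × ℝ)) (X := ℝ) (Y := ℝ × ℝ)).comp
      (hFc.prodMap (continuous_id (X := ℝ)))
    exact this
  · have := congrArg (fun g : BoundedContinuousFunction ℝ (ℝ × ℝ) => g s) (hF ε)
    simp only [Ψ, BoundedContinuousFunction.coe_ofNormedAddCommGroup] at this
    change E s • (F ε) s = _
    rw [← this, smul_inv_smul₀ (hE0 s).ne']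

/-! ### Smoothness across the singular point -/

/-- The weighted mean `∫₀¹ τ ^ m k(τ s) dτ` of `k` over the segment from `0` to `s`. -/
noncomputable def dilationMean (m : ℕ) (k : ℝ → ℝ) (s : ℝ) : ℝ :=
  ∫ τ in (0 : ℝ)..1, τ ^ m * k (τ * s)

theorem continuous_dilationMean (m : ℕ) {k : ℝ → ℝ} (hk : Continuous k) :
    Continuous (dilationMean m k) :=
  intervalIntegral.continuous_parametric_intervalIntegral_of_continuous'
    (f := fun s τ => τ ^ m * k (τ * s)) (by fun_prop) 0 1

theorem hasDerivAt_dilationMean (m : ℕ) {k : ℝ → ℝ} (hk : ContDiff ℝ 1 k) (s : ℝ) :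
    HasDerivAt (dilationMean m k) (dilationMean (m + 1) (deriv k) s) s := by
  have hc := hk.continuous
  have hd : Continuous (deriv k) := hk.continuous_deriv le_rfl
  obtain ⟨C, hC⟩ := (isCompact_Icc (a := -(|s| + 1)) (b := |s| + 1)).exists_bound_of_continuousOn
    hd.continuousOn
  have hC0 : 0 ≤ C := (norm_nonneg _).trans (hC 0 ⟨by have := abs_nonneg s; linarith, by positivity⟩)
  refine (intervalIntegral.hasDerivAt_integral_of_dominated_loc_of_deriv_le
    (F := fun s τ => τ ^ m * k (τ * s)) (F' := fun s τ => τ ^ (m + 1) * deriv k (τ * s))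
    (bound := fun _ => C) (Metric.ball_mem_nhds s one_pos)
    (Filter.Eventually.of_forall fun x => (by fun_prop : Continuous _).aestronglyMeasurable)
    ((by fun_prop : Continuous _).intervalIntegrable _ _)
    (by fun_prop : Continuous _).aestronglyMeasurable
    (Filter.Eventually.of_forall fun τ hτ x hx => ?_) (by simp)
    (Filter.Eventually.of_forall fun τ hτ x hx => ?_)).2
  · rw [uIoc_of_le zero_le_one] at hτ
    have h1 : |x| ≤ |s| + 1 := by
      have := abs_add_le (x - s) s
      rw [Metric.mem_ball, Real.dist_eq] at hx
      rw [sub_add_cancel] at this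
      linarith
    have h2 : |τ * x| ≤ |s| + 1 := by
      rw [abs_mul, abs_of_nonneg hτ.1.le]
      nlinarith [hτ.2, abs_nonneg x]
    have h3 := hC (τ * x) (abs_le.1 h2)
    rw [norm_mul, norm_pow, Real.norm_eq_abs τ, abs_of_nonneg hτ.1.le]
    have h4 := pow_le_one₀ (n := m + 1) hτ.1.le hτ.2
    nlinarith [norm_nonneg (deriv k (τ * x)), pow_nonneg hτ.1.le (m + 1)]
  · have h1 := (hk.differentiable one_ne_zero (τ * x)).hasDerivAt
    have h2 := (h1.comp x ((hasDerivAt_id x).const_mul τ)).const_mul (τ ^ m)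
    refine h2.congr_deriv ?_
    ring

theorem contDiff_dilationMean (n : ℕ) : ∀ (m : ℕ) {k : ℝ → ℝ}, ContDiff ℝ n k →
    ContDiff ℝ n (dilationMean m k) := by
  induction n with
  | zero => exact fun m k hk => contDiff_zero.2 (continuous_dilationMean m hk.continuous)
  | succ n ih =>
    intro m k hk
    have h1 : ContDiff ℝ 1 k := hk.of_le (by norm_cast; omega)
    have hd := hasDerivAt_dilationMean m h1
    push_cast at hk ⊢
    refine contDiff_succ_iff_deriv.2 ⟨fun s => (hd s).differentiableAt, by simp, ?_⟩
    rw [show deriv (dilationMean m k) = dilationMean (m + 1) (deriv k) from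
      funext fun s => (hd s).deriv]
    exact ih _ (contDiff_succ_iff_deriv.1 hk).2.2

theorem mul_integral_dilation (k : ℝ → ℝ) (s : ℝ) :
    s * ∫ τ in (0 : ℝ)..1, k (τ * s) = ∫ x in (0 : ℝ)..s, k x := by
  simp

/-- Multiplying the mean `dilationMean 1 k` by the variable gains one derivative, at `0` included. -/
theorem hasDerivAt_mul_dilationMean {k : ℝ → ℝ} (hk : Continuous k) (s : ℝ) :
    HasDerivAt (fun s => s * dilationMean 1 k s) (k s - dilationMean 1 k s) s := by
  have hc := continuous_dilationMean 1 hk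
  rcases eq_or_ne s 0 with rfl | hs
  · have h0 : dilationMean 1 k 0 = k 0 / 2 := by
      simp [dilationMean, div_eq_inv_mul]
    have : k 0 - dilationMean 1 k 0 = dilationMean 1 k 0 := by rw [h0]; ring
    rw [this, hasDerivAt_iff_tendsto_slope]
    refine ((hc.tendsto 0).mono_left nhdsWithin_le_nhds).congr' ?_
    filter_upwards [self_mem_nhdsWithin] with x hx
    have hx : x ≠ 0 := hx
    simp [slope_def_field, hx]
  · have hJ : ∀ x, x ≠ 0 → x * dilationMean 1 k x = x⁻¹ * ∫ y in (0 : ℝ)..x, y * k y := by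
      intro x hx
      rw [← mul_integral_dilation (fun y => y * k y) x, inv_mul_cancel_left₀ hx, dilationMean,
        ← intervalIntegral.integral_const_mul]
      refine intervalIntegral.integral_congr fun τ _ => ?_
      ring
    have hI : HasDerivAt (fun x => ∫ y in (0 : ℝ)..x, y * k y) (s * k s) s :=
      (by fun_prop : Continuous fun y => y * k y).integral_hasStrictDerivAt 0 s |>.hasDerivAt
    have h1 := (hasDerivAt_inv hs).mul hI
    have h2 : HasDerivAt (fun s => s * dilationMean 1 k s)
        (-(s ^ 2)⁻¹ * (∫ y in (0 : ℝ)..s, y * k y) + s⁻¹ * (s * k s)) s :=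
      h1.congr_of_eventuallyEq (by
        filter_upwards [isOpen_ne.mem_nhds hs] with x hx using hJ x hx)
    refine h2.congr_deriv ?_
    have h3 : (∫ y in (0 : ℝ)..s, y * k y) = s * (s * dilationMean 1 k s) := by
      rw [hJ s hs, mul_inv_cancel_left₀ hs]
    rw [h3]
    field_simp
    ring

theorem contDiff_mul_dilationMean (n : ℕ) {k : ℝ → ℝ} (hk : ContDiff ℝ n k) :
    ContDiff ℝ (n + 1) (fun s => s * dilationMean 1 k s) := by
  have hd := hasDerivAt_mul_dilationMean hk.continuous
  refine contDiff_succ_iff_deriv.2 ⟨fun s => (hd s).differentiableAt, by simp, ?_⟩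
  rw [show deriv (fun s => s * dilationMean 1 k s) = fun s => k s - dilationMean 1 k s from
    funext fun s => (hd s).deriv]
  exact hk.sub (contDiff_dilationMean n 1 hk)

/-- For smooth, bounded and Lipschitz `K` the singular system `v' = w`,
`(s w)' = -v / 2 + s K(ε, s, v, w)`, `v 0 = 1`, has solutions that are smooth on the whole line and
depend continuously on `ε`. Smoothness is a bootstrap: the system gives
`w(s) = -1 / 2 + s ∫₀¹ τ k(τ s) dτ` with `k = -(∫₀¹ w(τ s) dτ) / 2 + K`, so `w` is always one degree
smoother than `k`, which is as smooth as `w`. -/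
theorem exists_smooth_solution {K : ℝ × ℝ × ℝ × ℝ → ℝ} (hKs : ContDiff ℝ ∞ K) {L : NNReal}
    (hK : LipschitzWith L K) {C : ℝ} (hC : ∀ q, |K q| ≤ C) :
    ∃ v w : ℝ → ℝ → ℝ, (Continuous fun q : ℝ × ℝ => v q.1 q.2) ∧
      (Continuous fun q : ℝ × ℝ => w q.1 q.2) ∧ ∀ ε, ContDiff ℝ ∞ (v ε) ∧ ContDiff ℝ ∞ (w ε) ∧
      v ε 0 = 1 ∧ (∀ s, HasDerivAt (v ε) (w ε s) s) ∧
      ∀ s, HasDerivAt (fun s => s * w ε s) (-v ε s / 2 + s * K (ε, s, v ε s, w ε s)) s := by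
  obtain ⟨Y, hYc, hY⟩ := exists_shootOp_fixed hK hC
  refine ⟨fun ε s => (Y ε s).1, fun ε s => (Y ε s).2, hYc.fst, hYc.snd, fun ε => ?_⟩
  have hYε : Continuous (Y ε) := hYc.comp (by fun_prop : Continuous fun s : ℝ => (ε, s))
  set v : ℝ → ℝ := fun s => (Y ε s).1 with hv
  set w : ℝ → ℝ := fun s => (Y ε s).2 with hw
  have hvc : Continuous v := hYε.fst
  have hwc : Continuous w := hYε.snd
  have hKc := hK.continuous
  have hint : ∀ s, IntervalIntegrable (fun τ => shootIntegrand K ε s τ (Y ε (τ * s)))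
      MeasureTheory.volume 0 1 := fun s =>
    ((continuous_shootIntegrand hKc ε hYε).comp
      (by fun_prop : Continuous fun τ : ℝ => (s, τ))).intervalIntegrable _ _
  have hv1 : ∀ s, v s = 1 + s * dilationMean 0 w s := fun s => by
    have h1 := (ContinuousLinearMap.fst ℝ ℝ ℝ).intervalIntegral_comp_comm (hint s)
    simp only [hv]
    rw [hY ε s, shootOp, Prod.fst_add]
    simp only [ContinuousLinearMap.coe_fst'] at h1
    rw [← h1, dilationMean, ← intervalIntegral.integral_const_mul]
    simp [shootIntegrand, hw]
  have hw1 : ∀ s, w s = ∫ τ in (0 : ℝ)..1,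
      (-v (τ * s) / 2 + (τ * s) * K (ε, τ * s, v (τ * s), w (τ * s))) := fun s => by
    have h1 := (ContinuousLinearMap.snd ℝ ℝ ℝ).intervalIntegral_comp_comm (hint s)
    simp only [hw]
    rw [hY ε s, shootOp, Prod.snd_add]
    simp only [ContinuousLinearMap.coe_snd'] at h1
    rw [← h1]
    simp [shootIntegrand, hv]
  have hw2 : ∀ s, w s = -1 / 2 + s * dilationMean 1
      (fun x => -dilationMean 0 w x / 2 + K (ε, x, v x, w x)) s := fun s => by
    have c0 := continuous_dilationMean 0 hwc
    rw [hw1, dilationMean, ← intervalIntegral.integral_const_mul]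
    have : (-1 / 2 : ℝ) = ∫ τ in (0 : ℝ)..1, (-1 / 2 : ℝ) := by simp
    rw [this, ← intervalIntegral.integral_add (by simp)
      ((by fun_prop : Continuous _).intervalIntegrable _ _)]
    refine intervalIntegral.integral_congr fun τ _ => ?_
    simp only [hv1 (τ * s)]
    ring
  have hwn : ∀ n : ℕ, ContDiff ℝ n w := fun n => by
    induction n with
    | zero => exact contDiff_zero.2 hwc
    | succ n ih =>
      have a0 := contDiff_dilationMean n 0 ih
      have hvn : ContDiff ℝ n v := by
        rw [funext hv1]
        exact contDiff_const.add (contDiff_id.mul a0)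
      have hKn : ContDiff ℝ n K := hKs.of_le (by exact_mod_cast le_top)
      have hk : ContDiff ℝ n (fun x => -dilationMean 0 w x / 2 + K (ε, x, v x, w x)) :=
        (a0.neg.div_const 2).add
          (hKn.comp (contDiff_const.prodMk (contDiff_id.prodMk (hvn.prodMk ih))))
      rw [funext hw2]
      push_cast
      exact contDiff_const.add (contDiff_mul_dilationMean n hk)
  have hws : ContDiff ℝ ∞ w := contDiff_infty.2 hwn
  have hvs : ContDiff ℝ ∞ v := contDiff_infty.2 fun n => by
    rw [funext hv1]
    exact contDiff_const.add (contDiff_id.mul (contDiff_dilationMean n 0 (hwn n)))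
  refine ⟨hvs, hws, by change v 0 = 1; rw [hv1]; simp, fun s => ?_, fun s => ?_⟩
  · have h1 : v = fun s => 1 + ∫ x in (0 : ℝ)..s, w x := funext fun s => by
      rw [hv1, ← mul_integral_dilation]
      simp [dilationMean]
    change HasDerivAt v (w s) s
    rw [h1]
    exact ((hwc.integral_hasStrictDerivAt 0 s).hasDerivAt).const_add 1
  · have h1 : (fun s => s * w s) = fun s => ∫ x in (0 : ℝ)..s,
        (-v x / 2 + x * K (ε, x, v x, w x)) := funext fun s => by
      rw [← mul_integral_dilation, ← hw1]
    change HasDerivAt (fun s => s * w s) _ s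
    rw [h1]
    exact ((by fun_prop : Continuous fun x => -v x / 2 + x * K (ε, x, v x, w x)).integral_hasStrictDerivAt
      0 s).hasDerivAt

/-! ### The profile equation on the region where the truncation is inactive -/

/-- A solution `(v, w)`, `w = v'`, of the truncated profile equation with parameter `ε`; `b` is the
value of the cutoff along the solution, equal to `1` as long as all variables are at most `M`. -/
structure TruncatedSolution (M ε : ℝ) (v w b : ℝ → ℝ) : Prop where
  smooth_v : ContDiff ℝ ∞ v
  smooth_w : ContDiff ℝ ∞ w
  init : v 0 = 1
  deriv_v : ∀ s, HasDerivAt v (w s) s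
  deriv_mul_w : ∀ s, HasDerivAt (fun s => s * w s)
    (-v s / 2 + s * (b s * (w s - ε * w s ^ 2 * (v s + w s - 2 * s * w s)))) s
  cutoff_nonneg : ∀ s, 0 ≤ b s
  cutoff_le_one : ∀ s, b s ≤ 1
  cutoff_eq_one : ∀ s, |ε| ≤ M → |s| ≤ M → |v s| ≤ M → |w s| ≤ M → b s = 1

theorem exists_truncatedSolution {M : ℝ} (hM : 0 < M) :
    ∃ v w b : ℝ → ℝ → ℝ, (Continuous fun q : ℝ × ℝ => v q.1 q.2) ∧
      (Continuous fun q : ℝ × ℝ => w q.1 q.2) ∧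
      ∀ ε, TruncatedSolution M ε (v ε) (w ε) (b ε) := by
  let β : ContDiffBump (0 : ℝ × ℝ × ℝ × ℝ) := ⟨M, M + 1, hM, by linarith⟩
  let K : ℝ × ℝ × ℝ × ℝ → ℝ := fun q =>
    β q * (q.2.2.2 - q.1 * q.2.2.2 ^ 2 * (q.2.2.1 + q.2.2.2 - 2 * q.2.1 * q.2.2.2))
  have hKs : ContDiff ℝ ∞ K := by
    have : ContDiff ℝ ∞ β := β.contDiff
    fun_prop
  have hKc : HasCompactSupport K := β.hasCompactSupport.mul_right
  obtain ⟨L, hL⟩ := ContDiff.lipschitzWith_of_hasCompactSupport hKc hKs (by simp)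
  obtain ⟨C, hC⟩ := hKc.exists_bound_of_continuous hKs.continuous
  obtain ⟨v, w, hv, hw, h⟩ := exists_smooth_solution hKs hL hC
  refine ⟨v, w, fun ε s => β (ε, s, v ε s, w ε s), hv, hw, fun ε => ?_⟩
  obtain ⟨h1, h2, h3, h4, h5⟩ := h ε
  refine ⟨h1, h2, h3, h4, h5, fun s => β.nonneg, fun s => β.le_one, fun s a1 a2 a3 a4 => ?_⟩
  refine β.one_of_mem_closedBall ?_
  rw [mem_closedBall_zero_iff]
  exact max_le a1 (max_le a2 (max_le a3 a4))

namespace TruncatedSolution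

variable {M ε : ℝ} {v w b : ℝ → ℝ}

theorem hasDerivAt_w (h : TruncatedSolution M ε v w b) (s : ℝ) : HasDerivAt w (deriv w s) s :=
  (h.smooth_w.differentiable (by simp) s).hasDerivAt

theorem hasDerivAt_deriv_w (h : TruncatedSolution M ε v w b) (s : ℝ) :
    HasDerivAt (deriv w) (deriv (deriv w) s) s :=
  ((contDiff_infty_iff_deriv.1 h.smooth_w).2.differentiable (by simp) s).hasDerivAt

theorem equation (h : TruncatedSolution M ε v w b) (s : ℝ) :
    w s + s * deriv w s =
      -v s / 2 + s * (b s * (w s - ε * w s ^ 2 * (v s + w s - 2 * s * w s))) := by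
  have h1 := (hasDerivAt_id s).mul (h.hasDerivAt_w s)
  have := h1.unique (h.deriv_mul_w s)
  simpa using this

theorem w_zero (h : TruncatedSolution M ε v w b) : w 0 = -1 / 2 := by
  have := h.equation 0
  simpa [h.init] using this

variable {s₁ : ℝ}

/-- On an interval where `v` stays positive, `w` cannot cross zero upwards, because there
`2 s w' = -v`. -/
theorem w_nonpos (h : TruncatedSolution M ε v w b) (hv : ∀ s ∈ Ico 0 s₁, 0 < v s) :
    ∀ s ∈ Icc 0 s₁, w s ≤ 0 := by
  refine image_le_of_deriv_right_lt_deriv_boundary (B := fun _ => 0) (B' := fun _ => 0)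
    h.smooth_w.continuous.continuousOn (fun x _ => (h.hasDerivAt_w x).hasDerivWithinAt)
    (by rw [h.w_zero]; norm_num) (fun x => hasDerivAt_const _ _) fun x hx hwx => ?_
  have h1 := h.equation x
  rw [hwx] at h1
  have h2 := hv x hx
  by_contra! h3
  nlinarith [mul_nonneg hx.1 h3]

theorem v_mem_Icc (h : TruncatedSolution M ε v w b) (hv : ∀ s ∈ Ico 0 s₁, 0 < v s) :
    ∀ s ∈ Icc 0 s₁, v s ∈ Icc 0 1 := by
  have hanti : AntitoneOn v (Icc 0 s₁) := by
    refine antitoneOn_of_deriv_nonpos (convex_Icc _ _) h.smooth_v.continuous.continuousOn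
      (fun x _ => (h.deriv_v x).differentiableAt.differentiableWithinAt) fun x hx => ?_
    rw [(h.deriv_v x).deriv]
    exact h.w_nonpos hv x (interior_subset hx)
  intro s hs
  refine ⟨?_, h.init ▸ hanti ⟨le_rfl, hs.1.trans hs.2⟩ hs hs.1⟩
  rcases hs.2.lt_or_eq with h1 | rfl
  · exact (hv s ⟨hs.1, h1⟩).le
  · rcases hs.1.eq_or_lt with h0 | h0
    · rw [← h0, h.init]; exact zero_le_one
    · refine ge_of_tendsto (h.smooth_v.continuous.continuousWithinAt (s := Iio s)) ?_
      filter_upwards [Ioo_mem_nhdsLT h0] with x hx using (hv x ⟨hx.1.le, hx.2⟩).le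

theorem slope_le (h : TruncatedSolution M ε v w b)
    (hw : ∀ s ∈ Ico 0 s₁, 2 * s * ε * w s ^ 2 < 3) :
    ∀ s ∈ Icc 0 s₁, 2 * s * ε * w s ^ 2 ≤ 3 := by
  intro s hs
  rcases hs.2.lt_or_eq with h1 | rfl
  · exact (hw s ⟨hs.1, h1⟩).le
  · rcases hs.1.eq_or_lt with h0 | h0
    · rw [← h0]; norm_num
    · have hc := h.smooth_w.continuous
      refine le_of_tendsto ((by fun_prop : Continuous fun s => 2 * s * ε * w s ^ 2).continuousWithinAt
        (s := Iio s)) ?_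
      filter_upwards [Ioo_mem_nhdsLT h0] with x hx using (hw x ⟨hx.1.le, hx.2⟩).le

/-- An a priori bound for `w` that does not involve the cutoff: as long as the slope is bounded,
`y = s w` satisfies `y' ≥ 4 y - 2`. -/
theorem neg_le_w (h : TruncatedSolution M ε v w b) (hε : 0 ≤ ε) (hs₁ : s₁ ≤ 2)
    (hv : ∀ s ∈ Ico 0 s₁, 0 < v s) (hw : ∀ s ∈ Ico 0 s₁, 2 * s * ε * w s ^ 2 < 3) :
    ∀ s ∈ Icc 0 s₁, -(2 * Real.exp 8) ≤ w s := by
  have hd : ∀ s, HasDerivAt (fun s => (s * w s - 1 / 2) * Real.exp (-4 * s))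
      (((-v s / 2 + s * (b s * (w s - ε * w s ^ 2 * (v s + w s - 2 * s * w s)))) -
        4 * (s * w s) + 2) * Real.exp (-4 * s)) s := fun s => by
    have h1 := ((hasDerivAt_id s).const_mul (-4)).exp
    have h2 := ((h.deriv_mul_w s).sub_const (1 / 2)).mul h1
    refine h2.congr_deriv ?_
    simp only [id]
    ring
  have hmono : MonotoneOn (fun s => (s * w s - 1 / 2) * Real.exp (-4 * s)) (Icc 0 s₁) := by
    refine monotoneOn_of_deriv_nonneg (convex_Icc _ _)
      (fun x _ => (hd x).continuousAt.continuousWithinAt)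
      (fun x _ => (hd x).differentiableAt.differentiableWithinAt) fun x hx => ?_
    have hx := interior_subset hx
    rw [(hd x).deriv]
    refine mul_nonneg ?_ (Real.exp_pos _).le
    obtain ⟨v0, v1⟩ := h.v_mem_Icc hv x hx
    have w0 := h.w_nonpos hv x hx
    have hq := h.slope_le hw x hx
    have hxw : x * w x ≤ 0 := mul_nonpos_of_nonneg_of_nonpos hx.1 w0
    have hq0 : 0 ≤ x * ε * w x ^ 2 := by have := hx.1; positivity
    have h1 : x * ε * w x ^ 2 * (v x + w x - 2 * x * w x) ≤ 3 / 2 * (1 - 2 * (x * w x)) := by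
      have e1 : 0 ≤ x * ε * w x ^ 2 * ((1 - 2 * (x * w x)) - (v x + w x - 2 * x * w x)) :=
        mul_nonneg hq0 (by linarith)
      have e2 : 0 ≤ (3 / 2 - x * ε * w x ^ 2) * (1 - 2 * (x * w x)) :=
        mul_nonneg (by linarith) (by linarith)
      linarith
    have h2 : 4 * (x * w x) - 3 / 2 ≤
        b x * (x * w x - x * ε * w x ^ 2 * (v x + w x - 2 * x * w x)) := by
      have e1 := mul_le_mul_of_nonneg_left h1 (h.cutoff_nonneg x)
      have e2 : 0 ≤ (1 - b x) * (3 / 2 - 4 * (x * w x)) :=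
        mul_nonneg (by linarith [h.cutoff_le_one x]) (by linarith)
      linarith
    have h3 : x * (b x * (w x - ε * w x ^ 2 * (v x + w x - 2 * x * w x))) =
        b x * (x * w x - x * ε * w x ^ 2 * (v x + w x - 2 * x * w x)) := by ring
    rw [h3]
    linarith
  intro s hs
  rcases hs.1.eq_or_lt with h0 | h0
  · rw [← h0, h.w_zero]
    have := Real.add_one_le_exp 8
    linarith
  · have h1 := hmono ⟨le_rfl, hs.1.trans hs.2⟩ hs hs.1
    have h2 := Real.add_one_le_exp (-4 * s)
    have h3 : Real.exp (4 * s) ≤ Real.exp 8 := Real.exp_le_exp.2 (by linarith [hs.2])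
    have h4 : Real.exp (-4 * s) * Real.exp (4 * s) = 1 := by
      rw [← Real.exp_add]; simp
    have h5 := Real.exp_pos (4 * s)
    have h6 : s * w s - 1 / 2 ≥ -1 / 2 * Real.exp (4 * s) := by
      have h7 := mul_le_mul_of_nonneg_right h1 h5.le
      simp only [mul_assoc, h4] at h7
      norm_num at h7
      linarith
    have h8 : Real.exp (4 * s) - 1 ≤ 4 * s * Real.exp 8 := by
      have h9 := mul_le_mul_of_nonneg_right h2 h5.le
      rw [h4] at h9
      nlinarith
    by_contra! h9
    nlinarith [mul_lt_mul_of_pos_left h9 h0]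

/-- As long as `v > 0` and the slope is below the threshold, the a priori bounds keep all variables
away from the truncation. -/
theorem cutoff_eventually_eq_one (h : TruncatedSolution (2 * Real.exp 8 + 5) ε v w b)
    (hε : 0 ≤ ε) (hε4 : ε ≤ 4) (hs₁ : s₁ ≤ 2)
    (hv : ∀ s ∈ Ico 0 s₁, 0 < v s) (hw : ∀ s ∈ Ico 0 s₁, 2 * s * ε * w s ^ 2 < 3) :
    ∀ s ∈ Icc 0 s₁, ∀ᶠ x in 𝓝 s, b x = 1 := by
  intro s hs
  have e8 := Real.exp_pos 8
  have h1 := h.v_mem_Icc hv s hs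
  have h2 := h.w_nonpos hv s hs
  have h3 := h.neg_le_w hε hs₁ hv hw s hs
  have b1 : |s| < 2 * Real.exp 8 + 5 := abs_lt.2 ⟨by linarith [hs.1], by linarith [hs.2]⟩
  have b2 : |v s| < 2 * Real.exp 8 + 5 := abs_lt.2 ⟨by linarith [h1.1], by linarith [h1.2]⟩
  have b3 : |w s| < 2 * Real.exp 8 + 5 := abs_lt.2 ⟨by linarith, by linarith⟩
  filter_upwards [(continuous_abs.tendsto s).eventually (gt_mem_nhds b1),
    (h.smooth_v.continuous.abs.tendsto s).eventually (gt_mem_nhds b2),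
    (h.smooth_w.continuous.abs.tendsto s).eventually (gt_mem_nhds b3)] with x a1 a2 a3
  exact h.cutoff_eq_one x (abs_le.2 ⟨by linarith, by linarith⟩) a1.le a2.le a3.le

/-- The derivative of the untruncated equation. -/
theorem deriv_equation (h : TruncatedSolution M ε v w b) {s : ℝ} (hb : ∀ᶠ x in 𝓝 s, b x = 1) :
    2 * deriv w s + s * deriv (deriv w) s = -w s / 2 +
      (w s - ε * w s ^ 2 * (v s + w s - 2 * s * w s)) +
      s * (deriv w s - (2 * ε * w s * deriv w s * (v s + w s - 2 * s * w s) +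
        ε * w s ^ 2 * (w s + deriv w s - 2 * w s - 2 * s * deriv w s))) := by
  have hv := h.deriv_v s
  have hw := h.hasDerivAt_w s
  have hw' := h.hasDerivAt_deriv_w s
  have hs := hasDerivAt_id s
  have h1 : HasDerivAt (fun x => w x + x * deriv w x) _ s := hw.add (hs.mul hw')
  have h2 : HasDerivAt (fun x => -v x / 2 +
      x * (w x - ε * w x ^ 2 * (v x + w x - 2 * x * w x))) _ s :=
    (hv.neg.div_const 2).add (hs.mul (hw.sub (((hw.pow 2).const_mul ε).mul
      ((hv.add hw).sub ((hs.const_mul 2).mul hw)))))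
  have h3 : (fun x => w x + x * deriv w x) =ᶠ[𝓝 s] fun x => -v x / 2 +
      x * (w x - ε * w x ^ 2 * (v x + w x - 2 * x * w x)) := by
    filter_upwards [hb] with x hx
    rw [h.equation x, hx, one_mul]
  have h4 := (h1.congr_of_eventuallyEq h3.symm).unique h2
  simp only [id] at h4
  norm_num at h4
  linarith

/-- The profile is concave as a function of `s = r² / 2`: at a zero of `w'` the differentiated
equation reads `2 s w'' = w - 2 ε w² f + 2 s ε w³`, with `f = v + w - 2 s w > 0`. -/
theorem deriv_w_nonpos (h : TruncatedSolution M ε v w b) (hε : 0 ≤ ε)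
    (hv : ∀ s ∈ Ico 0 s₁, 0 < v s) (hb : ∀ s ∈ Icc 0 s₁, ∀ᶠ x in 𝓝 s, b x = 1) :
    ∀ s ∈ Icc 0 s₁, deriv w s ≤ 0 := by
  intro t ht
  have h0 : deriv w 0 < 0 := by
    have := h.deriv_equation (hb 0 ⟨le_rfl, ht.1.trans ht.2⟩)
    rw [h.w_zero, h.init] at this
    linarith
  refine image_le_of_deriv_right_lt_deriv_boundary (B := fun _ => 0) (B' := fun _ => 0)
    (contDiff_infty_iff_deriv.1 h.smooth_w).2.continuous.continuousOn
    (fun x _ => (h.hasDerivAt_deriv_w x).hasDerivWithinAt)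
    h0.le (fun x => hasDerivAt_const _ _) (fun x hx hwx => ?_) ht
  have hx' := Ico_subset_Icc_self hx
  have e1 := h.equation x
  have e2 := h.deriv_equation (hb x hx')
  rw [(hb x hx').self_of_nhds, hwx] at e1
  rw [hwx] at e2
  have vpos := hv x hx
  have w0 := h.w_nonpos hv x hx'
  have xpos : 0 < x := hx.1.lt_of_ne fun h1 => h0.ne (h1 ▸ hwx)
  set f := v x + w x - 2 * x * w x with hf
  have e3 : f * (1 + 2 * x * ε * w x ^ 2) = -w x := by
    linear_combination 2 * e1 + hf
  have wneg : w x < 0 := w0.lt_of_ne fun h1 => by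
    rw [h1] at e3 hf
    norm_num at e3 hf
    linarith
  have fpos : 0 < f := by
    by_contra! hf0
    have : 0 ≤ 2 * x * ε * w x ^ 2 := by positivity
    nlinarith
  have t1 : 0 ≤ ε * w x ^ 2 * f := by positivity
  have t2 : x * (ε * w x ^ 2) * w x ≤ 0 :=
    mul_nonpos_of_nonneg_of_nonpos (by positivity) w0
  by_contra! h3
  have := mul_nonneg xpos.le h3
  linarith

end TruncatedSolution

/-! ### Shooting -/

namespace TruncatedSolution

variable {ε : ℝ} {v w b : ℝ → ℝ} {s₁ : ℝ}

/-- The consequences of concavity used in the shooting argument. -/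
theorem concavity (h : TruncatedSolution (2 * Real.exp 8 + 5) ε v w b)
    (hε : 0 ≤ ε) (hε4 : ε ≤ 4) (hs₁ : s₁ ≤ 2)
    (hv : ∀ s ∈ Ico 0 s₁, 0 < v s) (hw : ∀ s ∈ Ico 0 s₁, 2 * s * ε * w s ^ 2 < 3) :
    ∀ s ∈ Icc 0 s₁, deriv w s ≤ 0 ∧ w s ≤ -1 / 2 ∧ v s ≤ 1 - s / 2 ∧ s * w s ≤ v s - 1 := by
  have hd := h.deriv_w_nonpos hε hv (h.cutoff_eventually_eq_one hε hε4 hs₁ hv hw)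
  have hanti : AntitoneOn w (Icc 0 s₁) :=
    antitoneOn_of_deriv_nonpos (convex_Icc _ _) h.smooth_w.continuous.continuousOn
      (fun x _ => (h.hasDerivAt_w x).differentiableAt.differentiableWithinAt)
      fun x hx => hd x (interior_subset hx)
  have hw2 : ∀ s ∈ Icc 0 s₁, w s ≤ -1 / 2 := fun s hs =>
    h.w_zero ▸ hanti ⟨le_rfl, hs.1.trans hs.2⟩ hs hs.1
  have d1 : ∀ s, HasDerivAt (fun s => v s + s / 2) (w s + 1 / 2) s := fun s =>
    (h.deriv_v s).add ((hasDerivAt_id s).div_const 2)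
  have anti1 : AntitoneOn (fun s => v s + s / 2) (Icc 0 s₁) :=
    antitoneOn_of_deriv_nonpos (convex_Icc _ _)
      (fun x _ => (d1 x).continuousAt.continuousWithinAt)
      (fun x _ => (d1 x).differentiableAt.differentiableWithinAt) fun x hx => by
        rw [(d1 x).deriv]
        linarith [hw2 x (interior_subset hx)]
  have d2 : ∀ s, HasDerivAt (fun s => v s - s * w s) (-(s * deriv w s)) s := fun s =>
    ((h.deriv_v s).sub ((hasDerivAt_id s).mul (h.hasDerivAt_w s))).congr_deriv (by
      simp only [id]; ring)
  have mono2 : MonotoneOn (fun s => v s - s * w s) (Icc 0 s₁) :=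
    monotoneOn_of_deriv_nonneg (convex_Icc _ _)
      (fun x _ => (d2 x).continuousAt.continuousWithinAt)
      (fun x _ => (d2 x).differentiableAt.differentiableWithinAt) fun x hx => by
        rw [(d2 x).deriv]
        have hx := interior_subset hx
        have := mul_nonpos_of_nonneg_of_nonpos hx.1 (hd x hx)
        linarith
  intro s hs
  have hz : (0 : ℝ) ∈ Icc 0 s₁ := ⟨le_rfl, hs.1.trans hs.2⟩
  have e1 := anti1 hz hs hs.1
  have e2 := mono2 hz hs hs.1
  simp only [h.init] at e1 e2
  exact ⟨hd s hs, hw2 s hs, by linarith, by linarith⟩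

/-- The first point at which the height vanishes or the slope reaches `√3` in absolute value. -/
theorem exists_exit (h : TruncatedSolution (2 * Real.exp 8 + 5) ε v w b)
    (hε : 0 ≤ ε) (hε4 : ε ≤ 4) :
    ∃ s₁, 0 < s₁ ∧ s₁ ≤ 2 ∧ (∀ s ∈ Ico 0 s₁, 0 < v s) ∧
      (∀ s ∈ Ico 0 s₁, 2 * s * ε * w s ^ 2 < 3) ∧ 0 ≤ v s₁ ∧ 2 * s₁ * ε * w s₁ ^ 2 ≤ 3 ∧
      (v s₁ = 0 ∨ 2 * s₁ * ε * w s₁ ^ 2 = 3) := by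
  have hvc := h.smooth_v.continuous
  have hwc := h.smooth_w.continuous
  have hcl : IsClosed {s | v s ≤ 0 ∨ 3 ≤ 2 * s * ε * w s ^ 2} :=
    (isClosed_le hvc continuous_const).union (isClosed_le continuous_const
      (by fun_prop : Continuous fun s => 2 * s * ε * w s ^ 2))
  have hne : (Icc 0 2 ∩ {s | v s ≤ 0 ∨ 3 ≤ 2 * s * ε * w s ^ 2}).Nonempty := by
    by_contra hcon
    rw [not_nonempty_iff_eq_empty] at hcon
    have hP : ∀ s ∈ Icc (0 : ℝ) 2, 0 < v s ∧ 2 * s * ε * w s ^ 2 < 3 := fun s hs => by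
      by_contra hc
      rw [not_and_or, not_lt, not_lt] at hc
      exact eq_empty_iff_forall_notMem.1 hcon s ⟨hs, hc⟩
    have h1 := (h.concavity hε hε4 le_rfl (fun s hs => (hP s (Ico_subset_Icc_self hs)).1)
      (fun s hs => (hP s (Ico_subset_Icc_self hs)).2) 2 ⟨by norm_num, le_rfl⟩).2.2.1
    have h2 := (hP 2 ⟨by norm_num, le_rfl⟩).1
    linarith
  obtain ⟨s₁, ⟨⟨h0, h2⟩, hs₁⟩, hmin⟩ := (isCompact_Icc.inter_right hcl).exists_isLeast hne
  have hP : ∀ s ∈ Ico 0 s₁, 0 < v s ∧ 2 * s * ε * w s ^ 2 < 3 := fun s hs => by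
    by_contra hc
    rw [not_and_or, not_lt, not_lt] at hc
    exact hs.2.not_ge (hmin ⟨⟨hs.1, hs.2.le.trans h2⟩, hc⟩)
  have hv := fun s hs => (hP s hs).1
  have hw := fun s hs => (hP s hs).2
  have a1 := (h.v_mem_Icc hv s₁ ⟨h0, le_rfl⟩).1
  have a2 := h.slope_le hw s₁ ⟨h0, le_rfl⟩
  refine ⟨s₁, h0.lt_of_ne fun h1 => ?_, h2, hv, hw, a1, a2, ?_⟩
  · rw [← h1] at hs₁
    rcases hs₁ with h3 | h3
    · rw [h.init] at h3; linarith
    · norm_num at h3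
  · exact hs₁.imp (fun h3 => le_antisymm h3 a1) (fun h3 => le_antisymm a2 h3)

end TruncatedSolution

theorem eventually_lt_of_hasDerivAt_pos {g : ℝ → ℝ} {g' x : ℝ} (hg : HasDerivAt g g' x)
    (h : 0 < g') : ∀ᶠ y in 𝓝[>] x, g x < g y := by
  have h1 := (hasDerivAt_iff_tendsto_slope.1 hg).eventually (lt_mem_nhds h)
  have h2 : 𝓝[>] x ≤ 𝓝[≠] x := nhdsWithin_mono _ fun y hy => (ne_of_gt hy : y ≠ x)
  filter_upwards [h2 h1, self_mem_nhdsWithin] with y hy hxy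
  rw [slope_def_field] at hy
  have := (div_pos_iff_of_pos_right (sub_pos.2 hxy)).1 hy
  linarith

/-- If an open condition holds on `[0, s₁]` and another one holds just after `s₁`, there is
`s > s₁` at which the second one holds and up to which the first one does. -/
theorem exists_gt_forall_Icc {P Q : ℝ → Prop} {s₁ : ℝ} (hP : ∀ s ∈ Ico 0 s₁, P s)
    (hP₁ : ∀ᶠ s in 𝓝 s₁, P s) (hQ : ∀ᶠ s in 𝓝[>] s₁, Q s) :
    ∃ s, s₁ < s ∧ (∀ σ ∈ Icc 0 s, P σ) ∧ Q s := by
  obtain ⟨δ, hδ, hball⟩ := Metric.eventually_nhds_iff.1 hP₁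
  have h1 : ∀ᶠ s in 𝓝[>] s₁, s ∈ Ioo s₁ (s₁ + δ) := Ioo_mem_nhdsGT (by linarith)
  obtain ⟨s, hs, hs'⟩ := (h1.and hQ).exists
  refine ⟨s, hs.1, fun σ hσ => ?_, hs'⟩
  rcases lt_or_ge σ s₁ with h2 | h2
  · exact hP σ ⟨hσ.1, h2⟩
  · refine hball ?_
    rw [Real.dist_eq, abs_of_nonneg (by linarith)]
    linarith [hσ.2, hs.2]

/-- The shooting argument. For `ε = 0` the height vanishes before the slope reaches the threshold,
for `ε = 4` the slope reaches it first; both alternatives are open in `ε`, so for some `ε` the two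
events happen at the same point. -/
theorem exists_critical_parameter {v w b : ℝ → ℝ → ℝ}
    (hvc : Continuous fun q : ℝ × ℝ => v q.1 q.2) (hwc : Continuous fun q : ℝ × ℝ => w q.1 q.2)
    (h : ∀ ε, TruncatedSolution (2 * Real.exp 8 + 5) ε (v ε) (w ε) (b ε)) :
    ∃ ε s₁, 0 ≤ ε ∧ ε ≤ 4 ∧ 0 < s₁ ∧ s₁ ≤ 2 ∧ (∀ s ∈ Ico 0 s₁, 0 < v ε s) ∧
      (∀ s ∈ Ico 0 s₁, 2 * s * ε * w ε s ^ 2 < 3) ∧ v ε s₁ = 0 ∧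
      2 * s₁ * ε * w ε s₁ ^ 2 = 3 := by
  let A : Set ℝ := {ε | ∃ s, 0 < s ∧ (∀ σ ∈ Icc 0 s, 0 < v ε σ) ∧ 3 < 2 * s * ε * w ε s ^ 2}
  let B : Set ℝ := {ε | ∃ s, 0 < s ∧ (∀ σ ∈ Icc 0 s, 2 * σ * ε * w ε σ ^ 2 < 3) ∧ v ε s < 0}
  have hqc : Continuous fun q : ℝ × ℝ => 2 * q.2 * q.1 * w q.1 q.2 ^ 2 := by fun_prop
  have hA : IsOpen A := by
    rw [isOpen_iff_mem_nhds]
    rintro ε ⟨s, hs, h1, h2⟩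
    have e1 : ∀ᶠ ε' in 𝓝 ε, ∀ σ ∈ Icc 0 s, 0 < v ε' σ :=
      isCompact_Icc.eventually_forall_of_forall_eventually fun σ hσ =>
        (hvc.tendsto (ε, σ)).eventually (lt_mem_nhds (h1 σ hσ))
    have e2 : ∀ᶠ ε' in 𝓝 ε, 3 < 2 * s * ε' * w ε' s ^ 2 :=
      ((hqc.comp (by fun_prop : Continuous fun ε' : ℝ => (ε', s))).tendsto ε).eventually
        (lt_mem_nhds h2)
    filter_upwards [e1, e2] with ε' a1 a2 using ⟨s, hs, a1, a2⟩
  have hB : IsOpen B := by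
    rw [isOpen_iff_mem_nhds]
    rintro ε ⟨s, hs, h1, h2⟩
    have e1 : ∀ᶠ ε' in 𝓝 ε, ∀ σ ∈ Icc 0 s, 2 * σ * ε' * w ε' σ ^ 2 < 3 :=
      isCompact_Icc.eventually_forall_of_forall_eventually fun σ hσ =>
        (hqc.tendsto (ε, σ)).eventually (gt_mem_nhds (h1 σ hσ))
    have e2 : ∀ᶠ ε' in 𝓝 ε, v ε' s < 0 :=
      ((hvc.comp (by fun_prop : Continuous fun ε' : ℝ => (ε', s))).tendsto ε).eventually
        (gt_mem_nhds h2)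
    filter_upwards [e1, e2] with ε' a1 a2 using ⟨s, hs, a1, a2⟩
  have hdisj : ∀ ε, ε ∈ A → ε ∈ B → False := by
    rintro ε ⟨s, hs, h1, h2⟩ ⟨s', hs', h1', h2'⟩
    rcases le_total s s' with hle | hle
    · linarith [h1' s ⟨hs.le, hle⟩]
    · linarith [h1 s' ⟨hs'.le, hle⟩]
  -- If the exit point is not a double one, the trajectory crosses the threshold it has reached.
  have crossA : ∀ ε s₁, 0 ≤ ε → ε ≤ 4 → 0 < s₁ → s₁ ≤ 2 → (∀ s ∈ Ico 0 s₁, 0 < v ε s) →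
      (∀ s ∈ Ico 0 s₁, 2 * s * ε * w ε s ^ 2 < 3) → 0 < v ε s₁ →
      2 * s₁ * ε * w ε s₁ ^ 2 = 3 → ε ∈ A := by
    intro ε s₁ h0 h4 hs hs2 hv hw hpos heq
    obtain ⟨c1, c2, -, -⟩ := (h ε).concavity h0 h4 hs2 hv hw s₁ ⟨hs.le, le_rfl⟩
    have hd := (((hasDerivAt_id s₁).const_mul (2 * ε)).mul (((h ε).hasDerivAt_w s₁).pow 2))
    have hεpos : 0 < ε := h0.lt_of_ne fun h1 => by rw [← h1] at heq; norm_num at heq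
    have hev := eventually_lt_of_hasDerivAt_pos hd (by
      simp only [id]
      norm_num
      have t1 : 0 < 2 * ε * w ε s₁ ^ 2 := by
        have : w ε s₁ ≠ 0 := by linarith
        positivity
      have t2 : 0 ≤ 2 * ε * s₁ * (2 * w ε s₁ * deriv (w ε) s₁) := by
        have := mul_nonneg_of_nonpos_of_nonpos (by linarith : w ε s₁ ≤ 0) c1
        have h3 : 0 ≤ 2 * ε * s₁ := by positivity
        have := mul_nonneg h3 this
        linarith
      linarith)
    obtain ⟨s, a1, a2, a3⟩ := exists_gt_forall_Icc hv
      (((h ε).smooth_v.continuous.tendsto s₁).eventually (lt_mem_nhds hpos)) hev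
    simp only [Pi.mul_apply, Pi.pow_apply, id] at a3
    exact ⟨s, hs.trans a1, a2, by linarith⟩
  have crossB : ∀ ε s₁, 0 ≤ ε → ε ≤ 4 → 0 < s₁ → s₁ ≤ 2 → (∀ s ∈ Ico 0 s₁, 0 < v ε s) →
      (∀ s ∈ Ico 0 s₁, 2 * s * ε * w ε s ^ 2 < 3) → v ε s₁ = 0 →
      2 * s₁ * ε * w ε s₁ ^ 2 < 3 → ε ∈ B := by
    intro ε s₁ h0 h4 hs hs2 hv hw hz hlt
    obtain ⟨-, c2, -, -⟩ := (h ε).concavity h0 h4 hs2 hv hw s₁ ⟨hs.le, le_rfl⟩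
    have hev := eventually_lt_of_hasDerivAt_pos ((h ε).deriv_v s₁).neg (by linarith)
    have hc := (h ε).smooth_w.continuous
    obtain ⟨s, a1, a2, a3⟩ := exists_gt_forall_Icc hw
      (((by fun_prop : Continuous fun s => 2 * s * ε * w ε s ^ 2).tendsto s₁).eventually
        (gt_mem_nhds hlt)) hev
    simp only [Pi.neg_apply] at a3
    exact ⟨s, hs.trans a1, a2, by linarith⟩
  have h0B : (0 : ℝ) ∈ B := by
    obtain ⟨s₁, hs, hs2, hv, hw, h1, h2, h3⟩ := (h 0).exists_exit le_rfl (by norm_num)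
    refine crossB 0 s₁ le_rfl (by norm_num) hs hs2 hv hw (h3.resolve_right ?_) ?_ <;> norm_num
  have h4A : (4 : ℝ) ∈ A := by
    obtain ⟨s₁, hs, hs2, hv, hw, h1, h2, h3⟩ := (h 4).exists_exit (by norm_num) le_rfl
    -- At a zero of `v`, concavity gives `s w ≤ -1`, so the squared slope is at least `2 ε / s ≥ ε`.
    have hne : v 4 s₁ ≠ 0 := fun hz => by
      obtain ⟨-, -, -, c⟩ := (h 4).concavity (by norm_num) le_rfl hs2 hv hw s₁ ⟨hs.le, le_rfl⟩
      rw [hz] at c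
      have c2 : 1 ≤ (s₁ * w 4 s₁) ^ 2 := by nlinarith
      have c3 : s₁ * (2 * s₁ * 4 * w 4 s₁ ^ 2) ≤ s₁ * 3 := mul_le_mul_of_nonneg_left h2 hs.le
      nlinarith
    exact crossA 4 s₁ (by norm_num) le_rfl hs hs2 hv hw (h1.lt_of_ne hne.symm)
      (h3.resolve_left hne)
  have hex : ∃ ε ∈ Icc (0 : ℝ) 4, ε ∉ A ∧ ε ∉ B := by
    by_contra! hcon
    obtain ⟨ε, -, e1, e2⟩ := isPreconnected_Icc (a := (0 : ℝ)) (b := 4) A B hA hB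
      (fun ε hε => or_iff_not_imp_left.2 fun hn => hcon ε hε hn)
      ⟨4, by norm_num, h4A⟩ ⟨0, by norm_num, h0B⟩
    exact hdisj ε e1 e2
  obtain ⟨ε, ⟨h0, h4⟩, hnA, hnB⟩ := hex
  obtain ⟨s₁, hs, hs2, hv, hw, h1, h2, h3⟩ := (h ε).exists_exit h0 h4
  have e1 : v ε s₁ = 0 := by
    by_contra hne
    exact hnA (crossA ε s₁ h0 h4 hs hs2 hv hw (h1.lt_of_ne (Ne.symm hne)) (h3.resolve_left hne))
  refine ⟨ε, s₁, h0, h4, hs, hs2, hv, hw, e1, ?_⟩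
  by_contra hne
  exact hnB (crossB ε s₁ h0 h4 hs hs2 hv hw e1 (h2.lt_of_ne hne))

/-- The equation `H + x^⊥ = 0` for the surface of revolution `z = V(r² / 2)`, at `s = r² / 2`. -/
def ProfileEquation (V : ℝ → ℝ) (s : ℝ) : Prop :=
  2 * s * deriv (deriv V) s + deriv V s +
    (V s + deriv V s - 2 * s * deriv V s) * (1 + 2 * s * deriv V s ^ 2) = 0

/-- There is a profile which solves the shrinker equation up to its first zero and has slope `-√3`
there. -/
theorem exists_profile : ∃ (V : ℝ → ℝ) (s₁ : ℝ), ContDiff ℝ ∞ V ∧ 0 < s₁ ∧ V s₁ = 0 ∧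
    (∀ s ∈ Ico 0 s₁, 0 < V s) ∧ (∀ s ∈ Icc 0 s₁, ProfileEquation V s) ∧
    √(2 * s₁) * deriv V s₁ = -√3 := by
  obtain ⟨v, w, b, hvc, hwc, h⟩ :=
    exists_truncatedSolution (M := 2 * Real.exp 8 + 5) (by positivity)
  obtain ⟨ε, s₁, h0, h4, hs, hs2, hv, hw, hz, hq⟩ := exists_critical_parameter hvc hwc h
  have h := h ε
  have hεpos : 0 < ε := h0.lt_of_ne fun h1 => by rw [← h1] at hq; norm_num at hq
  have hd1 : deriv (fun s => √ε * v ε s) = fun s => √ε * w ε s :=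
    funext fun s => ((h.deriv_v s).const_mul _).deriv
  have hd2 : deriv (fun s => √ε * w ε s) = fun s => √ε * deriv (w ε) s :=
    funext fun s => ((h.hasDerivAt_w s).const_mul _).deriv
  refine ⟨fun s => √ε * v ε s, s₁, contDiff_const.mul h.smooth_v, hs, by simp [hz],
    fun s hs => mul_pos (Real.sqrt_pos.2 hεpos) (hv s hs), fun s hs => ?_, ?_⟩
  · rw [ProfileEquation, hd1, hd2]
    have e1 := h.equation s
    rw [(h.cutoff_eventually_eq_one h0 h4 hs2 hv hw s hs).self_of_nhds] at e1
    have e2 := Real.sq_sqrt h0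
    linear_combination 2 * √ε * e1 +
      √ε * (v ε s + w ε s - 2 * s * w ε s) * 2 * s * w ε s ^ 2 * e2
  · rw [hd1]
    have c := (h.concavity h0 h4 hs2 hv hw s₁ ⟨hs.le, le_rfl⟩).2.1
    have e : √3 = √(2 * s₁) * (√ε * -w ε s₁) := by
      rw [← hq, Real.sqrt_mul (by positivity), Real.sqrt_mul (by positivity),
        ← neg_sq, Real.sqrt_sq (by linarith)]
      ring
    rw [e]; ring

/-! ### Computing the mean curvature in a parametrization -/

theorem inner_E3 (a b : E3) : ⟪a, b⟫ = a 0 * b 0 + a 1 * b 1 + a 2 * b 2 := by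
  simp [PiLp.inner_apply, Fin.sum_univ_three, mul_comm]

theorem fderiv_apply_eq (X : E2 → E3) (w v : E2) :
    fderiv ℝ X w v = v 0 • partialD X 0 w + v 1 • partialD X 1 w := by
  have : v = v 0 • EuclideanSpace.single 0 1 + v 1 • EuclideanSpace.single 1 1 := by
    ext i; fin_cases i <;> simp
  conv_lhs => rw [this]
  rw [map_add, map_smul, map_smul]
  rfl

theorem partialD_mem_tangentPlane (X : E2 → E3) (i : Fin 2) (w : E2) :
    partialD X i w ∈ tangentPlane X w :=
  ⟨EuclideanSpace.single i 1, rfl⟩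

theorem injective_fderiv_of_gram {X : E2 → E3} {w : E2}
    (hdet : ⟪partialD X 0 w, partialD X 0 w⟫ * ⟪partialD X 1 w, partialD X 1 w⟫ -
      ⟪partialD X 0 w, partialD X 1 w⟫ ^ 2 ≠ 0) : Function.Injective (fderiv ℝ X w) := by
  refine (injective_iff_map_eq_zero _).2 fun v hv => ?_
  rw [fderiv_apply_eq] at hv
  have h0 := congrArg (fun u => ⟪partialD X 0 w, u⟫) hv
  have h1 := congrArg (fun u => ⟪partialD X 1 w, u⟫) hv
  simp only [inner_add_right, inner_smul_right, inner_zero_right] at h0 h1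
  rw [real_inner_comm (partialD X 0 w) (partialD X 1 w)] at h1
  have e0 : v 0 = 0 := by
    refine (mul_eq_zero.1 ?_).resolve_left hdet
    linear_combination ⟪partialD X 1 w, partialD X 1 w⟫ * h0 -
      ⟪partialD X 0 w, partialD X 1 w⟫ * h1
  have e1 : v 1 = 0 := by
    refine (mul_eq_zero.1 ?_).resolve_left hdet
    linear_combination ⟪partialD X 0 w, partialD X 0 w⟫ * h1 -
      ⟪partialD X 0 w, partialD X 1 w⟫ * h0
  ext i; fin_cases i
  · exact e0
  · exact e1

theorem normalPart_eq_zero_of_inner {X : E2 → E3} {w : E2} (hX : Function.Injective (fderiv ℝ X w))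
    {ν v : E3} (hν : ν ≠ 0) (h0 : ⟪partialD X 0 w, ν⟫ = 0) (h1 : ⟪partialD X 1 w, ν⟫ = 0)
    (hv : ⟪v, ν⟫ = 0) : normalPart X w v = 0 := by
  have hνT : ν ∈ (tangentPlane X w)ᗮ := by
    rw [Submodule.mem_orthogonal]
    rintro _ ⟨u, rfl⟩
    change ⟪fderiv ℝ X w u, ν⟫ = 0
    rw [fderiv_apply_eq, inner_add_left, inner_smul_left, inner_smul_left, h0, h1]
    simp
  have hfin : Module.finrank ℝ (tangentPlane X w) = 2 := by
    rw [tangentPlane, LinearMap.finrank_range_of_inj hX]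
    simp
  have hfin' : Module.finrank ℝ (tangentPlane X w)ᗮ = 1 := by
    have := Submodule.finrank_add_finrank_orthogonal (tangentPlane X w)
    rw [hfin, finrank_euclideanSpace_fin] at this
    omega
  rw [normalPart, Submodule.starProjection_apply_eq_zero_iff, Submodule.mem_orthogonal]
  intro u hu
  obtain ⟨c, hc⟩ := (finrank_eq_one_iff_of_nonzero' (⟨ν, hνT⟩ : (tangentPlane X w)ᗮ)
    (by simpa [Subtype.ext_iff] using hν)).1 hfin' ⟨u, hu⟩
  have hc' : c • ν = u := congrArg Subtype.val hc
  rw [← hc', inner_smul_left, real_inner_comm, hv, mul_zero]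

/-- The shrinker equation tested against a normal vector `ν`, and multiplied by the determinant of
the first fundamental form. -/
theorem meanCurvatureVector_add_normalPart_eq_zero {X : E2 → E3} {w : E2} {x ν : E3} (hν : ν ≠ 0)
    (h0 : ⟪partialD X 0 w, ν⟫ = 0) (h1 : ⟪partialD X 1 w, ν⟫ = 0)
    (hdet : ⟪partialD X 0 w, partialD X 0 w⟫ * ⟪partialD X 1 w, partialD X 1 w⟫ -
      ⟪partialD X 0 w, partialD X 1 w⟫ ^ 2 ≠ 0)
    (h : ⟪partialD X 1 w, partialD X 1 w⟫ * ⟪partialD (partialD X 0) 0 w, ν⟫ -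
      ⟪partialD X 0 w, partialD X 1 w⟫ * (⟪partialD (partialD X 1) 0 w, ν⟫ +
        ⟪partialD (partialD X 0) 1 w, ν⟫) +
      ⟪partialD X 0 w, partialD X 0 w⟫ * ⟪partialD (partialD X 1) 1 w, ν⟫ +
      (⟪partialD X 0 w, partialD X 0 w⟫ * ⟪partialD X 1 w, partialD X 1 w⟫ -
        ⟪partialD X 0 w, partialD X 1 w⟫ ^ 2) * ⟪x, ν⟫ = 0) :
    meanCurvatureVector X w + normalPart X w x = 0 := by
  have e : meanCurvatureVector X w + normalPart X w x = normalPart X w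
      ((∑ i, ∑ j, ((firstFundamentalForm X w)⁻¹ i j) • partialD (partialD X j) i w) + x) := by
    simp only [meanCurvatureVector, normalPart, map_add, map_sum, map_smul]
  rw [e]
  refine normalPart_eq_zero_of_inner (injective_fderiv_of_gram hdet) hν h0 h1 ?_
  have hd : (firstFundamentalForm X w).det = ⟪partialD X 0 w, partialD X 0 w⟫ *
      ⟪partialD X 1 w, partialD X 1 w⟫ - ⟪partialD X 0 w, partialD X 1 w⟫ ^ 2 := by
    rw [Matrix.det_fin_two]
    simp only [firstFundamentalForm, Matrix.of_apply]
    rw [real_inner_comm (partialD X 0 w) (partialD X 1 w)]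
    ring
  have hc := real_inner_comm (partialD X 0 w) (partialD X 1 w)
  rw [Matrix.inv_def, hd, Ring.inverse_eq_inv', Matrix.adjugate_fin_two]
  simp only [firstFundamentalForm, Fin.sum_univ_two, Matrix.smul_apply, Matrix.of_apply,
    Matrix.cons_val', Matrix.cons_val_zero, Matrix.cons_val_one, Matrix.cons_val_fin_one,
    smul_eq_mul, inner_add_left, inner_smul_left, RCLike.conj_to_real]
  refine (mul_eq_zero.1 ?_).resolve_left hdet
  rw [hc]
  rw [← h]
  field_simp
  ring

/-! ### Coordinates -/

theorem hasDerivAt_of_coord {ι : Type*} [Fintype ι] {f : ℝ → EuclideanSpace ℝ ι}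
    {d : EuclideanSpace ℝ ι} {t : ℝ} (h : ∀ i, HasDerivAt (fun t => f t i) (d i) t) :
    HasDerivAt f d t := by
  rw [← hasDerivWithinAt_univ, hasDerivWithinAt_iff_hasFDerivWithinAt,
    hasFDerivWithinAt_euclidean]
  intro i
  rw [hasFDerivWithinAt_univ]
  exact (h i).hasFDerivAt

theorem hasDerivAt_E3 {a b c : ℝ → ℝ} {a' b' c' t : ℝ} (ha : HasDerivAt a a' t)
    (hb : HasDerivAt b b' t) (hc : HasDerivAt c c' t) :
    HasDerivAt (fun t => (!₂[a t, b t, c t] : E3)) !₂[a', b', c'] t :=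
  hasDerivAt_of_coord fun i => by
    fin_cases i
    · exact ha
    · exact hb
    · exact hc

theorem partialD_zero_eq {X : E2 → E3} {w : E2} {d : E3} (hX : DifferentiableAt ℝ X w)
    (hd : HasDerivAt (fun t => X !₂[t, w 1]) d (w 0)) : partialD X 0 w = d := by
  have hw : (!₂[w 0, w 1] : E2) = w := by ext i; fin_cases i <;> rfl
  have hγ : HasDerivAt (fun t : ℝ => (!₂[t, w 1] : E2)) (EuclideanSpace.single 0 1) (w 0) := by
    refine hasDerivAt_of_coord fun i => ?_
    fin_cases i
    · simpa using hasDerivAt_id' (w 0)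
    · simpa using hasDerivAt_const (w 0) (w 1)
  have hX' : HasFDerivAt X (fderiv ℝ X w) (!₂[w 0, w 1] : E2) := by rw [hw]; exact hX.hasFDerivAt
  exact (hX'.comp_hasDerivAt (w 0) hγ).unique hd

theorem partialD_one_eq {X : E2 → E3} {w : E2} {d : E3} (hX : DifferentiableAt ℝ X w)
    (hd : HasDerivAt (fun t => X !₂[w 0, t]) d (w 1)) : partialD X 1 w = d := by
  have hw : (!₂[w 0, w 1] : E2) = w := by ext i; fin_cases i <;> rfl
  have hγ : HasDerivAt (fun t : ℝ => (!₂[w 0, t] : E2)) (EuclideanSpace.single 1 1) (w 1) := by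
    refine hasDerivAt_of_coord fun i => ?_
    fin_cases i
    · simpa using hasDerivAt_const (w 1) (w 0)
    · simpa using hasDerivAt_id' (w 1)
  have hX' : HasFDerivAt X (fderiv ℝ X w) (!₂[w 0, w 1] : E2) := by rw [hw]; exact hX.hasFDerivAt
  exact (hX'.comp_hasDerivAt (w 1) hγ).unique hd

theorem contDiff_mk3 {n : WithTop ℕ∞} {a b c : E2 → ℝ} (ha : ContDiff ℝ n a) (hb : ContDiff ℝ n b)
    (hc : ContDiff ℝ n c) : ContDiff ℝ n (fun w => (!₂[a w, b w, c w] : E3)) := by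
  rw [contDiff_euclidean]
  intro i
  fin_cases i
  · exact ha
  · exact hb
  · exact hc

theorem contDiff_coord {ι : Type*} [Fintype ι] {n : WithTop ℕ∞} (i : ι) :
    ContDiff ℝ n (fun w : EuclideanSpace ℝ ι => w i) :=
  (EuclideanSpace.proj i : EuclideanSpace ℝ ι →L[ℝ] ℝ).contDiff

theorem continuous_coord {ι : Type*} [Fintype ι] (i : ι) :
    Continuous (fun w : EuclideanSpace ℝ ι => w i) :=
  (EuclideanSpace.proj i : EuclideanSpace ℝ ι →L[ℝ] ℝ).continuous

/-! ### The graph chart of a surface of revolution -/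

/-- The rotationally symmetric graph `z = V(r² / 2)`, parametrized by the horizontal coordinates,
the first of them translated by `c`. -/
noncomputable def graphChart (V : ℝ → ℝ) (c : ℝ) (w : E2) : E3 :=
  !₂[w 0 - c, w 1, V (((w 0 - c) ^ 2 + w 1 ^ 2) / 2)]

section
variable {V : ℝ → ℝ} (hV : ContDiff ℝ ∞ V)
include hV

theorem hasDerivAt_of_smooth (s : ℝ) : HasDerivAt V (deriv V s) s :=
  (hV.differentiable (by simp) s).hasDerivAt

theorem contDiff_deriv_of_smooth : ContDiff ℝ ∞ (deriv V) := (contDiff_infty_iff_deriv.1 hV).2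

theorem contDiff_graphChart (c : ℝ) : ContDiff ℝ ∞ (graphChart V c) := by
  have h0 := contDiff_coord (n := ∞) (0 : Fin 2)
  have h1 := contDiff_coord (n := ∞) (1 : Fin 2)
  exact contDiff_mk3 (by fun_prop) h1 (by fun_prop)

theorem hasDerivAt_revolution {a b : ℝ → ℝ} {a' b' t : ℝ} (ha : HasDerivAt a a' t)
    (hb : HasDerivAt b b' t) : HasDerivAt (fun t => V ((a t ^ 2 + b t ^ 2) / 2))
      ((a t * a' + b t * b') * deriv V ((a t ^ 2 + b t ^ 2) / 2)) t := by
  have := (hasDerivAt_of_smooth hV ((a t ^ 2 + b t ^ 2) / 2)).comp t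
    (((ha.pow 2).add (hb.pow 2)).div_const 2)
  refine this.congr_deriv ?_
  simp
  ring

theorem partialD_graphChart_zero (c : ℝ) : partialD (graphChart V c) 0 = fun w =>
    !₂[1, 0, (w 0 - c) * deriv V (((w 0 - c) ^ 2 + w 1 ^ 2) / 2)] := by
  ext1 w
  refine partialD_zero_eq ((contDiff_graphChart hV c).differentiable (by simp) w) ?_
  have h0 := (hasDerivAt_id (w 0)).sub_const c
  refine hasDerivAt_E3 h0 (hasDerivAt_const _ _) ?_
  exact (hasDerivAt_revolution hV h0 (hasDerivAt_const _ (w 1))).congr_deriv (by simp)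

theorem partialD_graphChart_one (c : ℝ) : partialD (graphChart V c) 1 = fun w =>
    !₂[0, 1, w 1 * deriv V (((w 0 - c) ^ 2 + w 1 ^ 2) / 2)] := by
  ext1 w
  refine partialD_one_eq ((contDiff_graphChart hV c).differentiable (by simp) w) ?_
  refine hasDerivAt_E3 (hasDerivAt_const (w 1) (w 0 - c)) (hasDerivAt_id _) ?_
  exact (hasDerivAt_revolution hV (hasDerivAt_const _ (w 0 - c)) (hasDerivAt_id (w 1))).congr_deriv
    (by simp)

theorem partialD_partialD_graphChart (c : ℝ) (w : E2) (s : ℝ)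
    (hs : s = ((w 0 - c) ^ 2 + w 1 ^ 2) / 2) :
    partialD (partialD (graphChart V c) 0) 0 w =
        !₂[0, 0, deriv V s + (w 0 - c) ^ 2 * deriv (deriv V) s] ∧
      partialD (partialD (graphChart V c) 0) 1 w =
        !₂[0, 0, (w 0 - c) * w 1 * deriv (deriv V) s] ∧
      partialD (partialD (graphChart V c) 1) 0 w =
        !₂[0, 0, (w 0 - c) * w 1 * deriv (deriv V) s] ∧
      partialD (partialD (graphChart V c) 1) 1 w =
        !₂[0, 0, deriv V s + w 1 ^ 2 * deriv (deriv V) s] := by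
  have hV' := contDiff_deriv_of_smooth hV
  have h0 := contDiff_coord (n := ∞) (0 : Fin 2)
  have h1 := contDiff_coord (n := ∞) (1 : Fin 2)
  have hd0 : DifferentiableAt ℝ (partialD (graphChart V c) 0) w := by
    rw [partialD_graphChart_zero hV]
    exact (contDiff_mk3 (n := ∞) (by fun_prop) (by fun_prop) (by fun_prop)).differentiable
      (by simp) w
  have hd1 : DifferentiableAt ℝ (partialD (graphChart V c) 1) w := by
    rw [partialD_graphChart_one hV]
    exact (contDiff_mk3 (n := ∞) (by fun_prop) (by fun_prop) (by fun_prop)).differentiable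
      (by simp) w
  have e0 := (hasDerivAt_id (w 0)).sub_const c
  have e1 := hasDerivAt_id (w 1)
  have f0 := hasDerivAt_revolution hV' e0 (hasDerivAt_const _ (w 1))
  have f1 := hasDerivAt_revolution hV' (hasDerivAt_const _ (w 0 - c)) e1
  refine ⟨partialD_zero_eq hd0 ?_, partialD_one_eq hd0 ?_, partialD_zero_eq hd1 ?_,
    partialD_one_eq hd1 ?_⟩
  all_goals
    first
    | rw [partialD_graphChart_zero hV]
    | rw [partialD_graphChart_one hV]
    refine hasDerivAt_E3 (hasDerivAt_const _ _) (hasDerivAt_const _ _) ?_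
  · refine (e0.mul f0).congr_deriv ?_
    simp [hs]; ring
  · refine (f1.const_mul (w 0 - c)).congr_deriv ?_
    simp [hs]; ring
  · refine (f0.const_mul (w 1)).congr_deriv ?_
    simp [hs]; ring
  · refine (e1.mul f1).congr_deriv ?_
    simp [hs]; ring

theorem immersion_graphChart (c : ℝ) (w : E2) :
    Function.Injective (fderiv ℝ (graphChart V c) w) := by
  refine injective_fderiv_of_gram ?_
  rw [partialD_graphChart_zero hV, partialD_graphChart_one hV]
  simp only [inner_E3]
  simp
  set D := deriv V (((w 0 - c) ^ 2 + w 1 ^ 2) / 2)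
  have : 0 < 1 + ((w 0 - c) * D) ^ 2 + (w 1 * D) ^ 2 := by positivity
  intro h
  nlinarith

theorem shrinker_graphChart (c : ℝ) (w : E2)
    (hode : ProfileEquation V (((w 0 - c) ^ 2 + w 1 ^ 2) / 2)) :
    meanCurvatureVector (graphChart V c) w +
      normalPart (graphChart V c) w (graphChart V c w) = 0 := by
  obtain ⟨a00, a01, a10, a11⟩ := partialD_partialD_graphChart hV c w _ rfl
  rw [ProfileEquation] at hode
  set s := ((w 0 - c) ^ 2 + w 1 ^ 2) / 2 with hs
  have b0 : partialD (graphChart V c) 0 w = !₂[1, 0, (w 0 - c) * deriv V s] := by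
    rw [partialD_graphChart_zero hV]
  have b1 : partialD (graphChart V c) 1 w = !₂[0, 1, w 1 * deriv V s] := by
    rw [partialD_graphChart_one hV]
  have bX : graphChart V c w = !₂[w 0 - c, w 1, V s] := rfl
  have hs2 : (w 0 - c) ^ 2 + w 1 ^ 2 = 2 * s := by rw [hs]; ring
  clear_value s
  refine meanCurvatureVector_add_normalPart_eq_zero
    (ν := !₂[-((w 0 - c) * deriv V s), -(w 1 * deriv V s), 1]) ?_ ?_ ?_ ?_ ?_
  · intro h
    have := congrArg (fun u : E3 => u 2) h
    simp at this
  · rw [b0, inner_E3]; simp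
  · rw [b1, inner_E3]; simp
  · rw [b0, b1]
    simp only [inner_E3]
    simp
    have : 0 < 1 + ((w 0 - c) * deriv V s) ^ 2 + (w 1 * deriv V s) ^ 2 := by positivity
    intro h
    nlinarith
  · rw [b0, b1, a00, a01, a10, a11, bX]
    simp only [inner_E3]
    simp
    generalize deriv V s = D at *
    generalize deriv (deriv V) s = D2 at *
    generalize w 0 - c = x at *
    generalize w 1 = y at *
    rw [← hs2] at hode
    linear_combination hode
end

/-! ### The polar chart of a surface of revolution -/

/-- The rotationally symmetric graph `z = V(r² / 2)` in polar coordinates: `w 0` is, up to the sign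
`σ`, the distance to the circle of radius `R`, and `w 1` is the angle measured from `θ`. -/
noncomputable def polarChart (V : ℝ → ℝ) (R σ θ : ℝ) (w : E2) : E3 :=
  !₂[(R + σ * w 0) * Real.cos (w 1 + θ), (R + σ * w 0) * Real.sin (w 1 + θ),
    V ((R + σ * w 0) ^ 2 / 2)]

section
variable {V : ℝ → ℝ} (hV : ContDiff ℝ ∞ V) (R σ θ : ℝ)
include hV

theorem contDiff_polarChart : ContDiff ℝ ∞ (polarChart V R σ θ) := by
  have h0 := contDiff_coord (n := ∞) (0 : Fin 2)
  have h1 := contDiff_coord (n := ∞) (1 : Fin 2)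
  exact contDiff_mk3 (by fun_prop) (by fun_prop) (by fun_prop)

theorem partialD_polarChart_zero : partialD (polarChart V R σ θ) 0 = fun w =>
    !₂[σ * Real.cos (w 1 + θ), σ * Real.sin (w 1 + θ),
      σ * ((R + σ * w 0) * deriv V ((R + σ * w 0) ^ 2 / 2))] := by
  ext1 w
  refine partialD_zero_eq ((contDiff_polarChart hV R σ θ).differentiable (by simp) w) ?_
  have h0 := ((hasDerivAt_id (w 0)).const_mul σ).const_add R
  refine hasDerivAt_E3 ((h0.mul_const (Real.cos (w 1 + θ))).congr_deriv ?_)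
    ((h0.mul_const (Real.sin (w 1 + θ))).congr_deriv ?_) ?_
  · simp
  · simp
  · have := (hasDerivAt_of_smooth hV ((R + σ * w 0) ^ 2 / 2)).comp (w 0) ((h0.pow 2).div_const 2)
    refine this.congr_deriv ?_
    simp
    ring

theorem partialD_polarChart_one : partialD (polarChart V R σ θ) 1 = fun w =>
    !₂[-((R + σ * w 0) * Real.sin (w 1 + θ)), (R + σ * w 0) * Real.cos (w 1 + θ), 0] := by
  ext1 w
  refine partialD_one_eq ((contDiff_polarChart hV R σ θ).differentiable (by simp) w) ?_
  have h1 := (hasDerivAt_id (w 1)).add_const θ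
  refine hasDerivAt_E3 ((h1.cos.const_mul (R + σ * w 0)).congr_deriv ?_)
    ((h1.sin.const_mul (R + σ * w 0)).congr_deriv ?_)
    (hasDerivAt_const (w 1) (V ((R + σ * w 0) ^ 2 / 2)))
  · simp
  · simp

theorem partialD_partialD_polarChart (hσ : σ ^ 2 = 1) (w : E2) (r s : ℝ) (hr : r = R + σ * w 0)
    (hs : s = r ^ 2 / 2) :
    partialD (partialD (polarChart V R σ θ) 0) 0 w =
        !₂[0, 0, deriv V s + r ^ 2 * deriv (deriv V) s] ∧
      partialD (partialD (polarChart V R σ θ) 1) 1 w =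
        !₂[-(r * Real.cos (w 1 + θ)), -(r * Real.sin (w 1 + θ)), 0] := by
  have hV' := contDiff_deriv_of_smooth hV
  have c0 := contDiff_coord (n := ∞) (0 : Fin 2)
  have c1 := contDiff_coord (n := ∞) (1 : Fin 2)
  have hd0 : DifferentiableAt ℝ (partialD (polarChart V R σ θ) 0) w := by
    rw [partialD_polarChart_zero hV]
    exact (contDiff_mk3 (n := ∞) (by fun_prop) (by fun_prop) (by fun_prop)).differentiable
      (by simp) w
  have hd1 : DifferentiableAt ℝ (partialD (polarChart V R σ θ) 1) w := by
    rw [partialD_polarChart_one hV]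
    exact (contDiff_mk3 (n := ∞) (by fun_prop) (by fun_prop) (by fun_prop)).differentiable
      (by simp) w
  have h0 := ((hasDerivAt_id (w 0)).const_mul σ).const_add R
  have h1 := (hasDerivAt_id (w 1)).add_const θ
  refine ⟨partialD_zero_eq hd0 ?_, partialD_one_eq hd1 ?_⟩
  · rw [partialD_polarChart_zero hV]
    refine hasDerivAt_E3 (hasDerivAt_const (w 0) (σ * Real.cos (w 1 + θ)))
      (hasDerivAt_const (w 0) (σ * Real.sin (w 1 + θ))) ?_
    have := (hasDerivAt_of_smooth hV' ((R + σ * w 0) ^ 2 / 2)).comp (w 0)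
      ((h0.pow 2).div_const 2)
    refine ((h0.mul this).const_mul σ).congr_deriv ?_
    rw [hs, hr]
    simp
    linear_combination (deriv V ((R + σ * w 0) ^ 2 / 2) +
      (R + σ * w 0) ^ 2 * deriv (deriv V) ((R + σ * w 0) ^ 2 / 2)) * hσ
  · rw [partialD_polarChart_one hV]
    refine hasDerivAt_E3 ((h1.sin.const_mul (R + σ * w 0)).neg.congr_deriv ?_)
      ((h1.cos.const_mul (R + σ * w 0)).congr_deriv ?_) (hasDerivAt_const _ _)
    · rw [hr]; simp
    · rw [hr]; simp

variable {R σ θ} in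
theorem gram_polarChart (hσ : σ ^ 2 = 1) (w : E2) (hr : 0 < R + σ * w 0) :
    ⟪partialD (polarChart V R σ θ) 0 w, partialD (polarChart V R σ θ) 0 w⟫ *
      ⟪partialD (polarChart V R σ θ) 1 w, partialD (polarChart V R σ θ) 1 w⟫ -
      ⟪partialD (polarChart V R σ θ) 0 w, partialD (polarChart V R σ θ) 1 w⟫ ^ 2 ≠ 0 := by
  rw [partialD_polarChart_zero hV, partialD_polarChart_one hV]
  simp only [inner_E3]
  simp
  have hcs := Real.sin_sq_add_cos_sq (w 1 + θ)
  set r := R + σ * w 0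
  set D := deriv V (r ^ 2 / 2)
  generalize Real.sin (w 1 + θ) = S at *
  generalize Real.cos (w 1 + θ) = C at *
  have : 0 < r ^ 2 * (1 + (r * D) ^ 2) := by positivity
  intro h
  have e : (σ * C * (σ * C) + σ * S * (σ * S) + σ * (r * D) * (σ * (r * D))) *
      (r * S * (r * S) + r * C * (r * C)) - (-(σ * C * (r * S)) + σ * S * (r * C)) ^ 2 =
      r ^ 2 * (1 + (r * D) ^ 2) := by
    have e1 : C ^ 2 = 1 - S ^ 2 := by linarith
    linear_combination (r ^ 2 * (S ^ 2 + C ^ 2 + (r * D) ^ 2) * (S ^ 2 + C ^ 2)) * hσ +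
      (r ^ 2 * (S ^ 2 + C ^ 2 + 1) + r ^ 2 * (r * D) ^ 2) * hcs
  linarith

variable {R σ θ} in
theorem shrinker_polarChart (hσ : σ ^ 2 = 1) (w : E2) (hr : 0 < R + σ * w 0)
    (hode : ProfileEquation V ((R + σ * w 0) ^ 2 / 2)) :
    meanCurvatureVector (polarChart V R σ θ) w +
      normalPart (polarChart V R σ θ) w (polarChart V R σ θ w) = 0 := by
  obtain ⟨a00, a11⟩ := partialD_partialD_polarChart hV R σ θ hσ w _ _ rfl rfl
  have hdet := gram_polarChart hV (θ := θ) hσ w hr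
  rw [ProfileEquation] at hode
  set r := R + σ * w 0 with hrdef
  have hs2 : r ^ 2 = 2 * (r ^ 2 / 2) := by ring
  set s := r ^ 2 / 2
  have hcs := Real.sin_sq_add_cos_sq (w 1 + θ)
  have b0 : partialD (polarChart V R σ θ) 0 w =
      !₂[σ * Real.cos (w 1 + θ), σ * Real.sin (w 1 + θ), σ * (r * deriv V s)] := by
    rw [partialD_polarChart_zero hV]
  have b1 : partialD (polarChart V R σ θ) 1 w =
      !₂[-(r * Real.sin (w 1 + θ)), r * Real.cos (w 1 + θ), 0] := by
    rw [partialD_polarChart_one hV]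
  have bX : polarChart V R σ θ w =
      !₂[r * Real.cos (w 1 + θ), r * Real.sin (w 1 + θ), V s] := rfl
  have b01 : ⟪partialD (polarChart V R σ θ) 0 w, partialD (polarChart V R σ θ) 1 w⟫ = 0 := by
    rw [b0, b1, inner_E3]
    simp
    ring
  have b00 : ⟪partialD (polarChart V R σ θ) 0 w, partialD (polarChart V R σ θ) 0 w⟫ =
      1 + (r * deriv V s) ^ 2 := by
    rw [b0, inner_E3]
    simp
    linear_combination (Real.sin (w 1 + θ) ^ 2 + Real.cos (w 1 + θ) ^ 2 + (r * deriv V s) ^ 2) * hσ +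
      hcs
  have b11 : ⟪partialD (polarChart V R σ θ) 1 w, partialD (polarChart V R σ θ) 1 w⟫ = r ^ 2 := by
    rw [b1, inner_E3]
    simp
    linear_combination r ^ 2 * hcs
  refine meanCurvatureVector_add_normalPart_eq_zero
    (ν := !₂[-(r * deriv V s * Real.cos (w 1 + θ)), -(r * deriv V s * Real.sin (w 1 + θ)), 1])
    ?_ ?_ ?_ hdet ?_
  · intro h
    have := congrArg (fun u : E3 => u 2) h
    simp at this
  · rw [b0, inner_E3]
    simp
    linear_combination -σ * (r * deriv V s) * hcs
  · rw [b1, inner_E3]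
    simp
    ring
  · rw [b00, b11, b01, a00, a11, bX]
    simp only [inner_E3]
    simp
    generalize deriv V s = D at *
    generalize deriv (deriv V) s = D2 at *
    generalize Real.sin (w 1 + θ) = S at *
    generalize Real.cos (w 1 + θ) = C at *
    rw [← hs2] at hode
    linear_combination r ^ 2 * hode + ((1 + (r * D) ^ 2) * (r ^ 2 * D - r ^ 4 * D)) * hcs
end

/-! ### Surfaces of revolution with boundary a horizontal circle -/

/-- The part of the graph `z = V(r² / 2)` inside (`σ = -1`) or outside (`σ = 1`) the circle of
radius `R`. -/
def revSurface (V : ℝ → ℝ) (R σ : ℝ) : Set E3 :=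
  {p | 0 ≤ σ * (p 0 ^ 2 + p 1 ^ 2 - R ^ 2) ∧ p 2 = V ((p 0 ^ 2 + p 1 ^ 2) / 2)}

/-- A local parametrization of a surface with boundary that satisfies the shrinker equation. -/
structure IsShrinkerChart (S Γ : Set E3) (X : E2 → E3) (W : Set E2) : Prop where
  isLocalParam : IsLocalParam S Γ X W
  shrinker : ∀ w ∈ W ∩ halfPlane, meanCurvatureVector X w + normalPart X w (X w) = 0

theorem isEmbedding_restrict {X : E2 → E3} {D : Set E2} (hX : Continuous X) (g : E3 → E2)
    (hg : Continuous g) (h : ∀ w ∈ D, g (X w) = w) : IsEmbedding (fun w : ↥D => X w) := by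
  refine IsEmbedding.of_comp (hX.comp continuous_subtype_val) hg ?_
  have : g ∘ (fun w : ↥D => X w) = Subtype.val := funext fun w => h w w.2
  rw [this]
  exact IsEmbedding.subtypeVal

theorem continuous_mk2 {α : Type*} [TopologicalSpace α] {a b : α → ℝ} (ha : Continuous a)
    (hb : Continuous b) : Continuous (fun x => (!₂[a x, b x] : E2)) := by
  refine (PiLp.continuous_toLp 2 _).comp (continuous_pi fun i => ?_)
  fin_cases i
  · exact ha
  · exact hb

theorem continuous_mk3 {α : Type*} [TopologicalSpace α] {a b c : α → ℝ} (ha : Continuous a)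
    (hb : Continuous b) (hc : Continuous c) : Continuous (fun x => (!₂[a x, b x, c x] : E3)) := by
  refine (PiLp.continuous_toLp 2 _).comp (continuous_pi fun i => ?_)
  fin_cases i
  · exact ha
  · exact hb
  · exact hc

/-- Away from the boundary circle the surface is covered by graph charts. The translation by
`|p 0| + 1` moves the chart into the open half-plane. -/
theorem exists_graphChart {V : ℝ → ℝ} (hV : ContDiff ℝ ∞ V) {R σ : ℝ}
    (hode : ∀ s, 0 ≤ s → 0 ≤ σ * (2 * s - R ^ 2) → ProfileEquation V s) {p : E3}
    (hp : p ∈ revSurface V R σ) (hpR : 0 < σ * (p 0 ^ 2 + p 1 ^ 2 - R ^ 2)) :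
    ∃ X W, IsShrinkerChart (revSurface V R σ) (horizontalCircle R) X W ∧
      ∃ w ∈ W ∩ halfPlane, X w = p := by
  set c := |p 0| + 1 with hc
  have hcp : 0 < p 0 + c := by
    have := neg_abs_le (p 0)
    linarith
  have k0 := continuous_coord (0 : Fin 2)
  have k1 := continuous_coord (1 : Fin 2)
  have l0 := continuous_coord (0 : Fin 3)
  have l1 := continuous_coord (1 : Fin 3)
  refine ⟨graphChart V c, {w | 0 < w 0 ∧ 0 < σ * ((w 0 - c) ^ 2 + w 1 ^ 2 - R ^ 2)},
    ⟨⟨?_, (contDiff_graphChart hV c).contDiffOn, fun w _ => immersion_graphChart hV c w, ?_,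
      ⟨{q | 0 < q 0 + c ∧ 0 < σ * (q 0 ^ 2 + q 1 ^ 2 - R ^ 2)}, ?_, ?_⟩, ?_⟩, ?_⟩, ?_⟩
  · refine IsOpen.and (isOpen_lt ?_ ?_) (isOpen_lt ?_ ?_) <;> fun_prop
  · refine isEmbedding_restrict (contDiff_graphChart hV c).continuous
      (fun q => !₂[q 0 + c, q 1]) (continuous_mk2 (by fun_prop) (by fun_prop)) fun w _ => ?_
    ext i; fin_cases i <;> simp [graphChart]
  · refine IsOpen.and (isOpen_lt ?_ ?_) (isOpen_lt ?_ ?_) <;> fun_prop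
  · ext q
    constructor
    · rintro ⟨w, ⟨⟨h0, h1⟩, -⟩, rfl⟩
      refine ⟨⟨?_, ?_⟩, ?_, ?_⟩ <;> simp [graphChart, h0, h1, h1.le]
    · rintro ⟨⟨-, h2⟩, h3, h4⟩
      refine ⟨!₂[q 0 + c, q 1], ⟨⟨?_, ?_⟩, ?_⟩, ?_⟩
      · simpa using h3
      · simpa using h4
      · simpa [halfPlane] using h3.le
      · ext i; fin_cases i <;> simp [graphChart, h2]
  · rintro w ⟨⟨h0, h1⟩, -⟩
    refine iff_of_false (fun h => ?_) h0.ne'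
    have h2 : (w 0 - c) ^ 2 + w 1 ^ 2 = R ^ 2 := h.2
    rw [h2] at h1
    simp at h1
  · rintro w ⟨⟨h0, h1⟩, -⟩
    refine shrinker_graphChart hV c w (hode _ (by positivity) ?_)
    have : 2 * (((w 0 - c) ^ 2 + w 1 ^ 2) / 2) = (w 0 - c) ^ 2 + w 1 ^ 2 := by ring
    rw [this]; exact h1.le
  · refine ⟨!₂[p 0 + c, p 1], ⟨⟨?_, ?_⟩, ?_⟩, ?_⟩
    · simpa using hcp
    · simpa using hpR
    · simpa [halfPlane] using hcp.le
    · ext i; fin_cases i <;> simp [graphChart, hp.2]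

/-- Near the boundary circle the surface is covered by polar charts. -/
theorem isShrinkerChart_polarChart {V : ℝ → ℝ} (hV : ContDiff ℝ ∞ V) {R σ : ℝ} (hR : 0 < R)
    (hσ : σ = 1 ∨ σ = -1) (hVR : V (R ^ 2 / 2) = 0)
    (hode : ∀ s, 0 ≤ s → 0 ≤ σ * (2 * s - R ^ 2) → ProfileEquation V s) (θ : ℝ) :
    IsShrinkerChart (revSurface V R σ) (horizontalCircle R) (polarChart V R σ θ)
      {w | |w 0| < R / 2 ∧ |w 1| < Real.pi / 2} := by
  have hσ2 : σ ^ 2 = 1 := by rcases hσ with rfl | rfl <;> norm_num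
  have hσabs : |σ| = 1 := by rcases hσ with rfl | rfl <;> norm_num
  have k0 := continuous_coord (0 : Fin 2)
  have k1 := continuous_coord (1 : Fin 2)
  have l0 := continuous_coord (0 : Fin 3)
  have l1 := continuous_coord (1 : Fin 3)
  have hr : ∀ w : E2, |w 0| < R / 2 → R / 2 < R + σ * w 0 ∧ R + σ * w 0 < 3 * R / 2 := by
    intro w hw
    have : |σ * w 0| < R / 2 := by rw [abs_mul, hσabs, one_mul]; exact hw
    rw [abs_lt] at this
    constructor <;> linarith
  -- `r² - R²` has the sign of `r - R`.
  have hsgn : ∀ w : E2, |w 0| < R / 2 →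
      (0 ≤ σ * ((R + σ * w 0) ^ 2 - R ^ 2) ↔ 0 ≤ w 0) := by
    intro w hw
    have h1 : σ * ((R + σ * w 0) ^ 2 - R ^ 2) = (R + (R + σ * w 0)) * w 0 := by
      linear_combination (2 * R * w 0 + σ * w 0 ^ 2) * hσ2
    rw [h1]
    exact mul_nonneg_iff_of_pos_left (by linarith [(hr w hw).1])
  have hsq : ∀ w : E2, ((R + σ * w 0) * Real.cos (w 1 + θ)) ^ 2 +
      ((R + σ * w 0) * Real.sin (w 1 + θ)) ^ 2 = (R + σ * w 0) ^ 2 := fun w => by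
    linear_combination (R + σ * w 0) ^ 2 * Real.sin_sq_add_cos_sq (w 1 + θ)
  have hsqrt : ∀ w : E2, |w 0| < R / 2 → √(((R + σ * w 0) * Real.cos (w 1 + θ)) ^ 2 +
      ((R + σ * w 0) * Real.sin (w 1 + θ)) ^ 2) = R + σ * w 0 := fun w hw => by
    rw [hsq, Real.sqrt_sq (by linarith [(hr w hw).1])]
  refine ⟨⟨?_, (contDiff_polarChart hV R σ θ).contDiffOn, fun w hw => ?_, ?_,
      ⟨{q | (R / 2 < √(q 0 ^ 2 + q 1 ^ 2) ∧ √(q 0 ^ 2 + q 1 ^ 2) < 3 * R / 2) ∧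
        0 < Real.cos θ * q 0 + Real.sin θ * q 1}, ?_, ?_⟩, ?_⟩, ?_⟩
  · refine IsOpen.and (isOpen_lt ?_ ?_) (isOpen_lt ?_ ?_) <;> fun_prop
  · exact injective_fderiv_of_gram (gram_polarChart hV hσ2 w (by linarith [(hr w hw.1).1]))
  · -- The denominator is kept away from zero to have a left inverse continuous on all of `ℝ³`.
    refine isEmbedding_restrict (contDiff_polarChart hV R σ θ).continuous
      (fun q => !₂[σ * (√(q 0 ^ 2 + q 1 ^ 2) - R),
        Real.arcsin ((Real.cos θ * q 1 - Real.sin θ * q 0) / max (√(q 0 ^ 2 + q 1 ^ 2)) (R / 2))])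
      (continuous_mk2 (by fun_prop) (Real.continuous_arcsin.comp (Continuous.div (by fun_prop)
        (by fun_prop) fun q => (lt_max_of_lt_right (half_pos hR)).ne'))) fun w hw => ?_
    have h1 := hsqrt w hw.1.1
    have h2 := hr w hw.1.1
    have h3 := abs_lt.1 hw.1.2
    ext i
    fin_cases i
    · simp only [polarChart]
      simp
      rw [h1]
      linear_combination w 0 * hσ2
    · simp only [polarChart]
      simp
      rw [h1, max_eq_left h2.1.le]
      have e : Real.cos θ * ((R + σ * w 0) * Real.sin (w 1 + θ)) -
          Real.sin θ * ((R + σ * w 0) * Real.cos (w 1 + θ)) = (R + σ * w 0) * Real.sin (w 1) := by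
        have : Real.sin (w 1) = Real.sin (w 1 + θ - θ) := by rw [add_sub_cancel_right]
        rw [this, Real.sin_sub]; ring
      rw [e, mul_div_cancel_left₀ _ (by linarith [h2.1]),
        Real.arcsin_sin (by linarith) (by linarith)]
  · refine IsOpen.and (IsOpen.and (isOpen_lt ?_ ?_) (isOpen_lt ?_ ?_)) (isOpen_lt ?_ ?_) <;> fun_prop
  · ext q
    constructor
    · rintro ⟨w, ⟨⟨h0, h1⟩, h2⟩, rfl⟩
      have h3 := hr w h0
      have h4 := abs_lt.1 h1
      refine ⟨⟨?_, ?_⟩, ?_, ?_⟩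
      · change 0 ≤ σ * (_ - _)
        simp only [polarChart]
        simp
        rw [hsq]
        exact (hsgn w h0).2 h2
      · simp only [polarChart]
        simp
        rw [hsq]
      · simp only [polarChart]
        simp
        rw [hsqrt w h0]
        exact h3
      · simp only [polarChart]
        simp
        have e : Real.cos θ * ((R + σ * w 0) * Real.cos (w 1 + θ)) +
            Real.sin θ * ((R + σ * w 0) * Real.sin (w 1 + θ)) =
            (R + σ * w 0) * Real.cos (w 1) := by
          have : Real.cos (w 1) = Real.cos (w 1 + θ - θ) := by rw [add_sub_cancel_right]
          rw [this, Real.cos_sub]; ring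
        rw [e]
        exact mul_pos (by linarith) (Real.cos_pos_of_mem_Ioo ⟨by linarith, h4.2⟩)
    · rintro ⟨⟨h1, h2⟩, ⟨h3, h4⟩, h5⟩
      set r := √(q 0 ^ 2 + q 1 ^ 2) with hrdef
      have hr2 : r ^ 2 = q 0 ^ 2 + q 1 ^ 2 := Real.sq_sqrt (by positivity)
      have hr0 : 0 < r := by linarith
      set A := Real.cos θ * q 0 + Real.sin θ * q 1 with hA
      set B := Real.cos θ * q 1 - Real.sin θ * q 0 with hB
      have hAB : A ^ 2 + B ^ 2 = r ^ 2 := by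
        rw [hr2, hA, hB]
        linear_combination (q 0 ^ 2 + q 1 ^ 2) * Real.sin_sq_add_cos_sq θ
      have hBr : |B| < r := abs_lt_of_sq_lt_sq (by nlinarith) hr0.le
      have hBr' := abs_lt.1 hBr
      have hb1 : -1 < B / r := by rw [lt_div_iff₀ hr0]; linarith
      have hb2 : B / r < 1 := by rw [div_lt_one hr0]; linarith
      have hsin : Real.sin (Real.arcsin (B / r)) = B / r := Real.sin_arcsin hb1.le hb2.le
      have hcos : Real.cos (Real.arcsin (B / r)) = A / r := by
        rw [Real.cos_arcsin, Real.sqrt_eq_iff_eq_sq (by nlinarith) (by positivity)]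
        field_simp
        linarith
      have hRσ : R + σ * (σ * (r - R)) = r := by linear_combination (r - R) * hσ2
      have habs : |σ * (r - R)| < R / 2 := by
        rw [abs_mul, hσabs, one_mul, abs_lt]
        constructor <;> linarith
      have hq0 : A * Real.cos θ - B * Real.sin θ = q 0 := by
        rw [hA, hB]
        linear_combination q 0 * Real.sin_sq_add_cos_sq θ
      have hq1 : B * Real.cos θ + A * Real.sin θ = q 1 := by
        rw [hA, hB]
        linear_combination q 1 * Real.sin_sq_add_cos_sq θ
      refine ⟨!₂[σ * (r - R), Real.arcsin (B / r)], ⟨⟨?_, ?_⟩, ?_⟩, ?_⟩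
      · simpa using habs
      · simp only [Matrix.cons_val_one, Matrix.cons_val_fin_one]
        exact abs_lt.2 ⟨Real.neg_pi_div_two_lt_arcsin.2 hb1, Real.arcsin_lt_pi_div_two.2 hb2⟩
      · have := (hsgn !₂[σ * (r - R), 0] (by simpa using habs)).1 (by
          simp
          rw [hRσ, hr2]; exact h1)
        simpa [halfPlane] using this
      · ext i
        fin_cases i
        · simp [polarChart]
          rw [hRσ, Real.cos_add, hsin, hcos, ← hq0]
          field_simp
        · simp [polarChart]
          rw [hRσ, Real.sin_add, hsin, hcos, ← hq1]
          field_simp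
        · simp [polarChart]
          rw [hRσ, hr2, h2]
  · rintro w ⟨⟨h0, h1⟩, h2⟩
    have h3 := hr w h0
    constructor
    · intro h
      have h4 : ((R + σ * w 0) * Real.cos (w 1 + θ)) ^ 2 +
        ((R + σ * w 0) * Real.sin (w 1 + θ)) ^ 2 = R ^ 2 := h.2
      rw [hsq] at h4
      have h5 : R + σ * w 0 = R := by
        rcases sq_eq_sq_iff_eq_or_eq_neg.1 h4 with h5 | h5 <;> linarith
      have h6 : σ * w 0 = 0 := by linarith
      exact (mul_eq_zero.1 h6).resolve_left (fun h => by simp [h] at hσ2)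
    · intro h
      refine ⟨?_, ?_⟩
      · simp [polarChart, h, hVR]
      · have := hsq w
        rw [h] at this
        simp only [mul_zero, add_zero] at this
        simpa [polarChart, h] using this
  · rintro w ⟨⟨h0, h1⟩, h2⟩
    refine shrinker_polarChart hV hσ2 w (by linarith [(hr w h0).1]) (hode _ (by positivity) ?_)
    have : 2 * ((R + σ * w 0) ^ 2 / 2) = (R + σ * w 0) ^ 2 := by ring
    rw [this]
    exact (hsgn w h0).2 h2

theorem exists_angle {x y R : ℝ} (hR : 0 < R) (h : x ^ 2 + y ^ 2 = R ^ 2) :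
    ∃ θ, x = R * Real.cos θ ∧ y = R * Real.sin θ := by
  have hn : ‖(⟨x, y⟩ : ℂ)‖ = R := by
    rw [Complex.norm_eq_sqrt_sq_add_sq]
    simp only
    rw [h, Real.sqrt_sq hR.le]
  refine ⟨Complex.arg ⟨x, y⟩, ?_, ?_⟩
  · rw [← hn, Complex.norm_mul_cos_arg]
  · rw [← hn, Complex.norm_mul_sin_arg]

theorem exists_polarChart_apply_zero {V : ℝ → ℝ} {R σ : ℝ} (hR : 0 < R)
    (hVR : V (R ^ 2 / 2) = 0) {p : E3} (hp : p ∈ horizontalCircle R) :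
    ∃ θ, polarChart V R σ θ 0 = p := by
  obtain ⟨θ, h0, h1⟩ := exists_angle hR hp.2
  refine ⟨θ, ?_⟩
  ext i
  fin_cases i
  · simp [polarChart, h0]
  · simp [polarChart, h1]
  · simp [polarChart, hVR, hp.1]

theorem exists_shrinkerChart {V : ℝ → ℝ} (hV : ContDiff ℝ ∞ V) {R σ : ℝ} (hR : 0 < R)
    (hσ : σ = 1 ∨ σ = -1) (hVR : V (R ^ 2 / 2) = 0)
    (hode : ∀ s, 0 ≤ s → 0 ≤ σ * (2 * s - R ^ 2) → ProfileEquation V s) {p : E3}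
    (hp : p ∈ revSurface V R σ) :
    ∃ X W, IsShrinkerChart (revSurface V R σ) (horizontalCircle R) X W ∧
      ∃ w ∈ W ∩ halfPlane, X w = p := by
  rcases hp.1.lt_or_eq with h | h
  · exact exists_graphChart hV hode hp h
  · have hσ0 : σ ≠ 0 := by rcases hσ with rfl | rfl <;> norm_num
    have h1 : p 0 ^ 2 + p 1 ^ 2 = R ^ 2 := by
      have := (mul_eq_zero.1 h.symm).resolve_left hσ0
      linarith
    obtain ⟨θ, hθ⟩ := exists_polarChart_apply_zero (σ := σ) hR hVR
      (p := p) ⟨by rw [hp.2, h1, hVR], h1⟩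
    refine ⟨_, _, isShrinkerChart_polarChart hV hR hσ hVR hode θ, 0, ⟨⟨?_, ?_⟩, ?_⟩, hθ⟩
    · simp [hR]
    · simp [Real.pi_pos]
    · simp [halfPlane]

theorem isInwardConormal_revSurface {V : ℝ → ℝ} (hV : ContDiff ℝ ∞ V) {R σ : ℝ} (hR : 0 < R)
    (hσ : σ = 1 ∨ σ = -1) (hVR : V (R ^ 2 / 2) = 0)
    (hode : ∀ s, 0 ≤ s → 0 ≤ σ * (2 * s - R ^ 2) → ProfileEquation V s) {θ k m : ℝ} {p : E3}
    (hp : polarChart V R σ θ 0 = p) (hk : 0 < k) (hm : m = R * deriv V (R ^ 2 / 2))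
    (hkm : k ^ 2 * (1 + m ^ 2) = 1) :
    IsInwardConormal (revSurface V R σ) (horizontalCircle R) p
      !₂[k * σ * Real.cos θ, k * σ * Real.sin θ, k * σ * m] := by
  have hσ2 : σ ^ 2 = 1 := by rcases hσ with rfl | rfl <;> norm_num
  have b0 : partialD (polarChart V R σ θ) 0 0 = !₂[σ * Real.cos θ, σ * Real.sin θ, σ * m] := by
    rw [partialD_polarChart_zero hV, hm]
    simp
  have b1 : partialD (polarChart V R σ θ) 1 0 =
      !₂[-(R * Real.sin θ), R * Real.cos θ, 0] := by
    rw [partialD_polarChart_one hV]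
    simp
  have hη : (!₂[k * σ * Real.cos θ, k * σ * Real.sin θ, k * σ * m] : E3) =
      k • partialD (polarChart V R σ θ) 0 0 := by
    rw [b0]
    ext i; fin_cases i <;> simp <;> ring
  have h00 : ⟪partialD (polarChart V R σ θ) 0 0, partialD (polarChart V R σ θ) 0 0⟫ =
      1 + m ^ 2 := by
    rw [b0, inner_E3]
    simp
    linear_combination (1 + m ^ 2) * hσ2 + σ ^ 2 * Real.sin_sq_add_cos_sq θ
  refine ⟨_, _, isShrinkerChart_polarChart hV hR hσ hVR hode θ |>.isLocalParam, 0, ⟨?_, ?_⟩, rfl,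
    hp, ?_, ?_, ?_, ?_⟩
  · simp [hR]
  · simp [Real.pi_pos]
  · rw [hη, norm_smul, Real.norm_eq_abs, abs_of_pos hk, ← sq_eq_sq₀ (by positivity) zero_le_one,
      mul_pow, ← real_inner_self_eq_norm_sq, h00, hkm, one_pow]
  · rw [hη]
    exact Submodule.smul_mem _ _ (partialD_mem_tangentPlane _ _ _)
  · rw [hη, inner_smul_left, b0, b1, inner_E3]
    simp
    right; ring
  · rw [hη, inner_smul_left, h00]
    simp only [RCLike.conj_to_real]
    positivity

/-! ### Homotheties and the shrinking flow -/

section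
variable {c : ℝ}

theorem fderiv_homothety (c : ℝ) (X : E2 → E3) (w : E2) :
    fderiv ℝ (fun w => c • X w) w = c • fderiv ℝ X w :=
  congrFun (fderiv_const_smul_field c (f := X)) w

theorem partialD_homothety (c : ℝ) (X : E2 → E3) (i : Fin 2) :
    partialD (fun w => c • X w) i = fun w => c • partialD X i w := by
  ext1 w
  rw [partialD, fderiv_homothety]
  rfl

theorem tangentPlane_homothety (hc : c ≠ 0) (X : E2 → E3) (w : E2) :
    tangentPlane (fun w => c • X w) w = tangentPlane X w := by
  rw [tangentPlane, fderiv_homothety, tangentPlane]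
  exact LinearMap.range_smul _ c hc

theorem normalPart_homothety (hc : c ≠ 0) (X : E2 → E3) (w : E2) (v : E3) :
    normalPart (fun w => c • X w) w v = normalPart X w v := by
  simp only [normalPart, tangentPlane_homothety hc]

theorem meanCurvatureVector_homothety (hc : c ≠ 0) (X : E2 → E3) (w : E2) :
    meanCurvatureVector (fun w => c • X w) w = c⁻¹ • meanCurvatureVector X w := by
  have hg : firstFundamentalForm (fun w => c • X w) w = (c * c) • firstFundamentalForm X w := by
    ext i j
    simp only [firstFundamentalForm, partialD_homothety, Matrix.of_apply, Matrix.smul_apply,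
      inner_smul_left, inner_smul_right, RCLike.conj_to_real, smul_eq_mul, mul_assoc]
  have hinv : (firstFundamentalForm (fun w => c • X w) w)⁻¹ =
      (c * c)⁻¹ • (firstFundamentalForm X w)⁻¹ := by
    rw [hg, Matrix.inv_def, Matrix.inv_def, Matrix.det_smul, Matrix.adjugate_smul,
      Ring.inverse_eq_inv', smul_smul, smul_smul, Fintype.card_fin, mul_inv,
      Nat.add_one_sub_one, pow_one]
    congr 1
    field_simp
  have hp : ∀ i j, partialD (partialD (fun w => c • X w) j) i w =
      c • partialD (partialD X j) i w := fun i j => by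
    rw [partialD_homothety, partialD_homothety]
  simp only [meanCurvatureVector, hinv, hp, normalPart_homothety hc, Finset.smul_sum]
  refine Finset.sum_congr rfl fun i _ => Finset.sum_congr rfl fun j _ => ?_
  simp only [normalPart, map_smul, Matrix.smul_apply, smul_smul, smul_eq_mul]
  congr 1
  field_simp

theorem IsLocalParam.homothety (hc : c ≠ 0) {S Γ : Set E3} {X : E2 → E3} {W : Set E2}
    (h : IsLocalParam S Γ X W) : IsLocalParam (c • S) (c • Γ) (fun w => c • X w) W where
  isOpen := h.isOpen
  smooth := h.smooth.const_smul c
  immersion w hw := by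
    rw [fderiv_homothety]
    exact fun a b hab => h.immersion w hw (smul_right_injective _ hc hab)
  embedding := (Homeomorph.smulOfNeZero c hc).isEmbedding.comp h.embedding
  image := by
    obtain ⟨U, hU, h1⟩ := h.image
    refine ⟨c • U, hU.smul₀ hc, ?_⟩
    rw [← smul_set_inter₀ hc, ← h1, ← image_smul, image_image]
  boundary w hw := by
    rw [smul_mem_smul_set_iff₀ hc]
    exact h.boundary w hw

theorem IsInwardConormal.homothety (hc : 0 < c) {S Γ : Set E3} {p η : E3}
    (h : IsInwardConormal S Γ p η) : IsInwardConormal (c • S) (c • Γ) (c • p) η := by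
  obtain ⟨X, W, hX, w, hw, h0, hp, h1, h2, h3, h4⟩ := h
  refine ⟨_, W, hX.homothety hc.ne', w, hw, h0, by rw [hp], h1, ?_, ?_, ?_⟩
  · rwa [tangentPlane_homothety hc.ne']
  · rw [partialD_homothety, inner_smul_right, h3, mul_zero]
  · rw [partialD_homothety, inner_smul_right]
    exact mul_pos hc h4

theorem IsTripleCluster.homothety (hc : 0 < c) {S : Fin 3 → Set E3} {Γ : Set E3}
    (h : IsTripleCluster S Γ) : IsTripleCluster (fun i => c • S i) (c • Γ) where
  surface i := by
    refine ⟨smul_set_mono (h.surface i).1, ?_⟩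
    rintro _ ⟨p, hp, rfl⟩
    obtain ⟨X, W, hX, w, hw, rfl⟩ := (h.surface i).2 p hp
    exact ⟨_, W, hX.homothety hc.ne', w, hw, rfl⟩
  meet i j hij := by rw [← smul_set_inter₀ hc.ne', h.meet i j hij]
  angle := by
    rintro _ ⟨p, hp, rfl⟩
    obtain ⟨η, h1, h2⟩ := h.angle p hp
    exact ⟨η, fun i => (h1 i).homothety hc, h2⟩

end

theorem sqrt_shrink_pos {t : ℝ} (ht : t ∈ Iio (1 / 2 : ℝ)) : 0 < √(1 - 2 * t) :=
  Real.sqrt_pos.2 (by have := mem_Iio.1 ht; linarith)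

theorem hasDerivAt_sqrt_shrink {t : ℝ} (ht : t ∈ Iio (1 / 2 : ℝ)) :
    HasDerivAt (fun τ => √(1 - 2 * τ)) (-(√(1 - 2 * t))⁻¹) t := by
  have hpos := sqrt_shrink_pos ht
  have h := (((hasDerivAt_id t).const_mul 2).const_sub 1).sqrt (by
    have := mem_Iio.1 ht
    simp only [id]
    linarith)
  refine h.congr_deriv ?_
  simp only [id]
  field_simp

/-- If a surface is covered by charts satisfying `H + x^⊥ = 0`, then its homothetic images
`√(1 - 2t) S` have normal velocity `-x^⊥ / √(1 - 2t) = H / √(1 - 2t)`, which is their mean curvature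
vector. -/
theorem movesByMeanCurvature_of_shrinker {S Γ : Set E3}
    (h : ∀ p ∈ S, ∃ X W, IsShrinkerChart S Γ X W ∧ ∃ w ∈ W ∩ halfPlane, X w = p) :
    MovesByMeanCurvature (fun t => √(1 - 2 * t) • S) (fun t => √(1 - 2 * t) • Γ)
      (Iio (1 / 2)) := by
  rintro t₀ ht₀ _ ⟨p, hp, rfl⟩
  obtain ⟨X, W, hX, w, hw, rfl⟩ := h p hp
  refine ⟨Iio (1 / 2), W, fun t w => √(1 - 2 * t) • X w, isOpen_Iio, ht₀, subset_rfl, ?_, ?_,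
    ⟨w, hw, rfl⟩, ?_⟩
  · refine ContDiffOn.smul (ContDiffOn.sqrt (by fun_prop) fun q hq => ?_)
      (hX.isLocalParam.smooth.comp contDiffOn_snd fun q hq => hq.2)
    have := mem_Iio.1 hq.1
    linarith
  · exact fun t ht => hX.isLocalParam.homothety (sqrt_shrink_pos ht).ne'
  · intro t ht w hw
    have hpos := sqrt_shrink_pos ht
    rw [normalPart_homothety hpos.ne', meanCurvatureVector_homothety hpos.ne',
      ((hasDerivAt_sqrt_shrink ht).smul_const (X w)).deriv,
      eq_neg_of_add_eq_zero_left (hX.shrinker w hw), normalPart, map_smul, ← normalPart,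
      smul_neg, neg_smul]

theorem isSelfShrinker_of_charts {S : Fin 3 → Set E3} {Γ : Set E3} (hS : IsTripleCluster S Γ)
    (h : ∀ i, ∀ p ∈ S i, ∃ X W, IsShrinkerChart (S i) Γ X W ∧ ∃ w ∈ W ∩ halfPlane, X w = p) :
    IsSelfShrinker S Γ :=
  ⟨fun _ ht => hS.homothety (sqrt_shrink_pos ht),
    fun i => movesByMeanCurvature_of_shrinker (h i)⟩

/-! ### The lens-shaped cluster -/

theorem rotateVertical_image_revSurface (V : ℝ → ℝ) (R σ θ : ℝ) :
    rotateVertical θ '' revSurface V R σ = revSurface V R σ := by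
  have hsub : ∀ θ, ∀ p ∈ revSurface V R σ, rotateVertical θ p ∈ revSurface V R σ := by
    intro θ p hp
    have h : (Real.cos θ * p 0 - Real.sin θ * p 1) ^ 2 +
        (Real.sin θ * p 0 + Real.cos θ * p 1) ^ 2 = p 0 ^ 2 + p 1 ^ 2 := by
      linear_combination (p 0 ^ 2 + p 1 ^ 2) * Real.sin_sq_add_cos_sq θ
    constructor
    · simp only [rotateVertical]
      simp
      rw [h]; exact hp.1
    · simp only [rotateVertical]
      simp
      rw [h]; exact hp.2
  refine Subset.antisymm (image_subset_iff.2 (hsub θ)) fun p hp => ⟨_, hsub (-θ) p hp, ?_⟩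
  have hcs := Real.sin_sq_add_cos_sq θ
  ext i
  fin_cases i
  · simp [rotateVertical]
    linear_combination p 0 * hcs
  · simp [rotateVertical]
    linear_combination p 1 * hcs
  · simp [rotateVertical]

theorem reflectHorizontal_reflectHorizontal (p : E3) :
    reflectHorizontal (reflectHorizontal p) = p := by
  ext i; fin_cases i <;> simp [reflectHorizontal]

theorem reflectHorizontal_image_revSurface (V : ℝ → ℝ) (R σ : ℝ) :
    reflectHorizontal '' revSurface V R σ = revSurface (fun s => -V s) R σ := by
  ext p
  constructor
  · rintro ⟨q, hq, rfl⟩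
    exact ⟨by simpa [reflectHorizontal] using hq.1, by simpa [reflectHorizontal] using hq.2⟩
  · intro hp
    refine ⟨reflectHorizontal p, ⟨?_, ?_⟩, reflectHorizontal_reflectHorizontal p⟩
    · simpa [reflectHorizontal] using hp.1
    · have := hp.2
      simp [reflectHorizontal, this]

theorem outerPlane_eq_revSurface (R : ℝ) : outerPlane R = revSurface (fun _ => 0) R 1 := by
  ext p
  simp [outerPlane, revSurface, and_comm]

/-- The part of the graph inside the circle is homeomorphic to the closed unit disc, through the
horizontal coordinates divided by `R`. -/
noncomputable def capHomeomorph {V : ℝ → ℝ} (hV : Continuous V) {R : ℝ} (hR : 0 < R) :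
    revSurface V R (-1) ≃ₜ Metric.closedBall (0 : E2) 1 where
  toFun p := ⟨!₂[p.1 0 / R, p.1 1 / R], by
    rw [mem_closedBall_zero_iff, ← sq_le_one_iff₀ (norm_nonneg _), EuclideanSpace.norm_sq_eq,
      Fin.sum_univ_two]
    simp only [Real.norm_eq_abs, sq_abs]
    simp only [Matrix.cons_val_zero, Matrix.cons_val_one, Matrix.cons_val_fin_one, div_pow]
    rw [← add_div, div_le_one (by positivity)]
    have := p.2.1
    linarith⟩
  invFun w := ⟨!₂[R * w.1 0, R * w.1 1, V (((R * w.1 0) ^ 2 + (R * w.1 1) ^ 2) / 2)], by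
    have h := mem_closedBall_zero_iff.1 w.2
    rw [← sq_le_one_iff₀ (norm_nonneg _), EuclideanSpace.norm_sq_eq, Fin.sum_univ_two] at h
    simp only [Real.norm_eq_abs, sq_abs] at h
    refine ⟨?_, by simp⟩
    simp
    nlinarith [sq_nonneg R]⟩
  left_inv p := by
    ext i
    have h := p.2.2
    fin_cases i
    · simp; field_simp
    · simp; field_simp
    · simp [h]; field_simp
  right_inv w := by
    ext i
    fin_cases i
    · simp; field_simp
    · simp; field_simp
  continuous_toFun := by
    have l0 := continuous_coord (0 : Fin 3)
    have l1 := continuous_coord (1 : Fin 3)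
    exact Continuous.subtype_mk (continuous_mk2 (by fun_prop) (by fun_prop)) _
  continuous_invFun := by
    have l0 := continuous_coord (0 : Fin 2)
    have l1 := continuous_coord (1 : Fin 2)
    exact Continuous.subtype_mk (continuous_mk3 (by fun_prop) (by fun_prop) (by fun_prop)) _

theorem isBounded_cap {V : ℝ → ℝ} (hV : Continuous V) {R : ℝ} (hR : 0 < R) :
    Bornology.IsBounded (revSurface V R (-1)) := by
  have : CompactSpace (revSurface V R (-1)) := (capHomeomorph hV hR).symm.compactSpace
  exact (isCompact_iff_compactSpace.2 this).isBounded

theorem not_isBounded_outerPlane (R : ℝ) : ¬ Bornology.IsBounded (outerPlane R) := by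
  intro h
  obtain ⟨C, hC⟩ := h.exists_norm_le
  have hmem : (!₂[|R| + |C| + 1, 0, 0] : E3) ∈ outerPlane R := by
    refine ⟨by simp, ?_⟩
    simp
    rw [← sq_abs R]
    exact pow_le_pow_left₀ (abs_nonneg R) (by linarith [abs_nonneg C]) 2
  have h1 := hC _ hmem
  have h2 := (PiLp.norm_apply_le (!₂[|R| + |C| + 1, 0, 0] : E3) 0).trans h1
  simp only [Matrix.cons_val_zero, Real.norm_eq_abs] at h2
  have h3 := le_abs_self (|R| + |C| + 1)
  linarith [le_abs_self C, abs_nonneg R]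

theorem ProfileEquation.neg {V : ℝ → ℝ} {s : ℝ} (h : ProfileEquation V s) :
    ProfileEquation (fun s => -V s) s := by
  have h1 : deriv (fun s => -V s) = fun s => -deriv V s := deriv.fun_neg'
  have h2 : deriv (fun s => -deriv V s) = fun s => -deriv (deriv V) s := deriv.fun_neg'
  rw [ProfileEquation] at h ⊢
  rw [h1, h2]
  linear_combination -h

theorem profileEquation_zero (s : ℝ) : ProfileEquation (fun _ => 0) s := by
  simp [ProfileEquation]

theorem angle_eq_of_inner {a b : E3} (ha : ‖a‖ = 1) (hb : ‖b‖ = 1) (h : ⟪a, b⟫ = -1 / 2) :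
    InnerProductGeometry.angle a b = 2 * Real.pi / 3 := by
  rw [InnerProductGeometry.angle, ha, hb, h]
  have : (-1 / 2 / (1 * 1) : ℝ) = Real.cos (2 * Real.pi / 3) := by
    have e : 2 * Real.pi / 3 = Real.pi - Real.pi / 3 := by ring
    rw [e, Real.cos_pi_sub, Real.cos_pi_div_three]
    norm_num
  rw [this, Real.arccos_cos (by positivity) (by linarith [Real.pi_pos])]

/-- The profiles of the three surfaces of the cluster. -/
def lensProfile (V : ℝ → ℝ) : Fin 3 → ℝ → ℝ := ![V, fun s => -V s, fun _ => 0]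

/-- The side of the circle on which each surface of the cluster lies. -/
def lensSide : Fin 3 → ℝ := ![-1, -1, 1]

/-- The cluster formed by a cap with profile `V`, its reflection and the outer plane. -/
def lensCluster (V : ℝ → ℝ) (R : ℝ) (i : Fin 3) : Set E3 :=
  revSurface (lensProfile V i) R (lensSide i)

section
variable {V : ℝ → ℝ} {R : ℝ}

theorem lensSide_eq (i : Fin 3) : lensSide i = 1 ∨ lensSide i = -1 := by
  fin_cases i <;> simp [lensSide]

theorem contDiff_lensProfile (hV : ContDiff ℝ ∞ V) (i : Fin 3) :
    ContDiff ℝ ∞ (lensProfile V i) := by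
  fin_cases i
  · exact hV
  · exact hV.neg
  · exact contDiff_const

theorem lensProfile_boundary (hVR : V (R ^ 2 / 2) = 0) (i : Fin 3) :
    lensProfile V i (R ^ 2 / 2) = 0 := by
  fin_cases i <;> simp [lensProfile, hVR]

theorem lensProfile_equation (hode : ∀ s ∈ Icc 0 (R ^ 2 / 2), ProfileEquation V s) (i : Fin 3)
    (s : ℝ) (hs : 0 ≤ s) (hsR : 0 ≤ lensSide i * (2 * s - R ^ 2)) :
    ProfileEquation (lensProfile V i) s := by
  fin_cases i
  · refine hode s ⟨hs, ?_⟩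
    simp [lensSide] at hsR
    linarith
  · refine (hode s ⟨hs, ?_⟩).neg
    simp [lensSide] at hsR
    linarith
  · exact profileEquation_zero s

/-- The slopes of the three surfaces at the circle are `-√3`, `√3` and `0`, so their unit conormals
are `(-e_r ± √3 e_z) / 2` and `e_r`. -/
theorem lensCluster_angle (hV : ContDiff ℝ ∞ V) (hR : 0 < R) (hVR : V (R ^ 2 / 2) = 0)
    (hode : ∀ s ∈ Icc 0 (R ^ 2 / 2), ProfileEquation V s)
    (hslope : R * deriv V (R ^ 2 / 2) = -√3) {p : E3} (hp : p ∈ horizontalCircle R) :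
    ∃ η : Fin 3 → E3, (∀ i, IsInwardConormal (lensCluster V R i) (horizontalCircle R) p (η i)) ∧
      ∀ i j, i ≠ j → InnerProductGeometry.angle (η i) (η j) = 2 * Real.pi / 3 := by
  have h3 : √3 ^ 2 = (3 : ℝ) := Real.sq_sqrt (by norm_num)
  obtain ⟨θ, h0, h1⟩ := exists_angle hR hp.2
  have hpθ : ∀ i, polarChart (lensProfile V i) R (lensSide i) θ 0 = p := fun i => by
    have := lensProfile_boundary hVR i
    ext k; fin_cases k <;> simp [polarChart, h0, h1, this, hp.1]
  let k : Fin 3 → ℝ := ![1 / 2, 1 / 2, 1]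
  let m : Fin 3 → ℝ := ![-√3, √3, 0]
  have hk : ∀ i, 0 < k i := by intro i; fin_cases i <;> simp [k]
  have hm : ∀ i, m i = R * deriv (lensProfile V i) (R ^ 2 / 2) := by
    intro i
    fin_cases i
    · exact hslope.symm
    · have : deriv (fun s => -V s) (R ^ 2 / 2) = -deriv V (R ^ 2 / 2) := deriv.fun_neg
      change √3 = R * deriv (fun s => -V s) (R ^ 2 / 2)
      rw [this]; linarith
    · change 0 = R * deriv (fun _ => (0 : ℝ)) (R ^ 2 / 2)
      simp
  have hkm : ∀ i, k i ^ 2 * (1 + m i ^ 2) = 1 := by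
    intro i
    fin_cases i <;> simp [k, m, h3] <;> norm_num
  have hη : ∀ i, IsInwardConormal (lensCluster V R i) (horizontalCircle R) p
      !₂[k i * lensSide i * Real.cos θ, k i * lensSide i * Real.sin θ,
        k i * lensSide i * m i] := fun i =>
    isInwardConormal_revSurface (contDiff_lensProfile hV i) hR (lensSide_eq i)
      (lensProfile_boundary hVR i) (lensProfile_equation hode i) (hpθ i) (hk i) (hm i) (hkm i)
  refine ⟨_, hη, fun i j hij => angle_eq_of_inner ?_ ?_ ?_⟩
  · obtain ⟨X, W, -, w, -, -, -, h, -⟩ := hη i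
    exact h
  · obtain ⟨X, W, -, w, -, -, -, h, -⟩ := hη j
    exact h
  · have hcs := Real.sin_sq_add_cos_sq θ
    rw [inner_E3]
    fin_cases i <;> fin_cases j <;> simp [k, m, lensSide] at hij ⊢ <;> nlinarith

theorem isTripleCluster_lensCluster (hV : ContDiff ℝ ∞ V) (hR : 0 < R) (hVR : V (R ^ 2 / 2) = 0)
    (hpos : ∀ s ∈ Ico 0 (R ^ 2 / 2), 0 < V s)
    (hode : ∀ s ∈ Icc 0 (R ^ 2 / 2), ProfileEquation V s)
    (hslope : R * deriv V (R ^ 2 / 2) = -√3) :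
    IsTripleCluster (lensCluster V R) (horizontalCircle R) := by
  have hΓ : ∀ i, horizontalCircle R ⊆ lensCluster V R i := fun i p hp =>
    ⟨by rw [hp.2]; simp, by rw [hp.1, hp.2, lensProfile_boundary hVR]⟩
  -- A point of the plane on one of the caps is on the circle.
  have hcap : ∀ p : E3, p 0 ^ 2 + p 1 ^ 2 ≤ R ^ 2 → V ((p 0 ^ 2 + p 1 ^ 2) / 2) = 0 →
      p 0 ^ 2 + p 1 ^ 2 = R ^ 2 := by
    intro p h1 h2
    by_contra hne
    have h3 : p 0 ^ 2 + p 1 ^ 2 < R ^ 2 := h1.lt_of_ne hne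
    exact (hpos _ ⟨by positivity, by linarith⟩).ne' h2
  have h01 : lensCluster V R 0 ∩ lensCluster V R 1 ⊆ horizontalCircle R := by
    rintro p ⟨⟨a1, a2⟩, ⟨-, b2⟩⟩
    simp [lensProfile, lensSide] at a1 a2 b2
    have hz : p 2 = 0 := by linarith
    exact ⟨hz, hcap p a1 (by rw [← a2, hz])⟩
  have h02 : lensCluster V R 0 ∩ lensCluster V R 2 ⊆ horizontalCircle R := by
    rintro p ⟨⟨a1, -⟩, ⟨b1, b2⟩⟩
    simp [lensProfile, lensSide] at a1 b1 b2
    exact ⟨b2, le_antisymm a1 b1⟩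
  have h12 : lensCluster V R 1 ∩ lensCluster V R 2 ⊆ horizontalCircle R := by
    rintro p ⟨⟨a1, -⟩, ⟨b1, b2⟩⟩
    simp [lensProfile, lensSide] at a1 b1 b2
    exact ⟨b2, le_antisymm a1 b1⟩
  refine ⟨fun i => ⟨hΓ i, fun p hp => ?_⟩, fun i j hij =>
    Subset.antisymm ?_ (subset_inter (hΓ i) (hΓ j)),
    fun p hp => lensCluster_angle hV hR hVR hode hslope hp⟩
  · obtain ⟨X, W, hX, hw⟩ := exists_shrinkerChart (contDiff_lensProfile hV i) hR (lensSide_eq i)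
      (lensProfile_boundary hVR i) (lensProfile_equation hode i) hp
    exact ⟨X, W, hX.isLocalParam, hw⟩
  · fin_cases i <;> fin_cases j <;> simp at hij ⊢
    · exact h01
    · exact h02
    · rw [inter_comm]; exact h01
    · exact h12
    · rw [inter_comm]; exact h02
    · rw [inter_comm]; exact h12

theorem isLensShaped_lensCluster (hV : Continuous V) (hR : 0 < R)
    (hpos : ∀ s ∈ Ico 0 (R ^ 2 / 2), 0 < V s) (hVR : V (R ^ 2 / 2) = 0) :
    IsLensShaped (lensCluster V R) R where
  pos := hR
  disc := ⟨capHomeomorph hV hR⟩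
  above := by
    rintro p ⟨⟨h1, h2⟩, h3⟩
    simp [lensProfile, lensSide] at h1 h2
    rw [h2]
    have hne : p 0 ^ 2 + p 1 ^ 2 ≠ R ^ 2 := fun h => h3 ⟨by rw [h2, h, hVR], h⟩
    have := h1.lt_of_ne hne
    exact hpos _ ⟨by positivity, by linarith⟩
  reflect := (reflectHorizontal_image_revSurface V R (-1)).symm
  outer := (outerPlane_eq_revSurface R).symm

theorem isBounded_lensCluster_iff (hV : Continuous V) (hR : 0 < R) (i : Fin 3) :
    Bornology.IsBounded (lensCluster V R i) ↔ i ≠ 2 := by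
  fin_cases i
  · exact iff_of_true (isBounded_cap hV hR) (by decide)
  · exact iff_of_true (isBounded_cap hV.neg hR) (by decide)
  · refine iff_of_false ?_ (by decide)
    have := not_isBounded_outerPlane R
    rwa [outerPlane_eq_revSurface] at this

theorem reflectHorizontal_image_lensCluster (V : ℝ → ℝ) (R : ℝ) :
    reflectHorizontal '' (⋃ i, lensCluster V R i) = ⋃ i, lensCluster V R i := by
  have hsub : ∀ p ∈ ⋃ i, lensCluster V R i, reflectHorizontal p ∈ ⋃ i, lensCluster V R i := by
    intro p hp
    obtain ⟨i, hi⟩ := mem_iUnion.1 hp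
    have h := mem_image_of_mem reflectHorizontal hi
    rw [lensCluster, reflectHorizontal_image_revSurface] at h
    fin_cases i
    · exact mem_iUnion.2 ⟨1, h⟩
    · refine mem_iUnion.2 ⟨0, ?_⟩
      simpa [lensCluster, lensProfile, lensSide] using h
    · refine mem_iUnion.2 ⟨2, ?_⟩
      simpa [lensCluster, lensProfile, lensSide] using h
  exact Subset.antisymm (image_subset_iff.2 hsub) fun p hp =>
    ⟨_, hsub p hp, reflectHorizontal_reflectHorizontal p⟩

end

theorem theorem1p1 :
    ∃ (S : Fin 3 → Set E3) (R : ℝ),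
      IsLensShaped S R ∧
      (∀ i, Bornology.IsBounded (S i) ↔ i ≠ 2) ∧
      (∀ i, ∀ θ : ℝ, rotateVertical θ '' S i = S i) ∧
      reflectHorizontal '' (⋃ i, S i) = ⋃ i, S i ∧
      IsTripleCluster S (horizontalCircle R) ∧
      (∀ i, ShrinkerEquation (S i) (horizontalCircle R)) ∧
      IsSelfShrinker S (horizontalCircle R) := by
  obtain ⟨V, s₁, hV, hs₁, hz, hpos, hode, hslope⟩ := exists_profile
  have hR : 0 < √(2 * s₁) := Real.sqrt_pos.2 (by linarith)
  have hRs : √(2 * s₁) ^ 2 / 2 = s₁ := by rw [Real.sq_sqrt (by linarith)]; ring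
  set R := √(2 * s₁)
  rw [← hRs] at hz hpos hode hslope
  have hT := isTripleCluster_lensCluster hV hR hz hpos hode hslope
  have hC : ∀ i, ∀ p ∈ lensCluster V R i, ∃ X W,
      IsShrinkerChart (lensCluster V R i) (horizontalCircle R) X W ∧
        ∃ w ∈ W ∩ halfPlane, X w = p := fun i p hp =>
    exists_shrinkerChart (contDiff_lensProfile hV i) hR (lensSide_eq i)
      (lensProfile_boundary hz i) (lensProfile_equation hode i) hp
  refine ⟨lensCluster V R, R, isLensShaped_lensCluster hV.continuous hR hpos hz,
    isBounded_lensCluster_iff hV.continuous hR,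
    fun i θ => rotateVertical_image_revSurface _ _ _ θ,
    reflectHorizontal_image_lensCluster V R, hT, fun i p hp => ?_,
    isSelfShrinker_of_charts hT hC⟩
  obtain ⟨X, W, hX, w, hw, rfl⟩ := hC i p hp
  exact ⟨X, W, hX.isLocalParam, w, hw, rfl, hX.shrinker w hw⟩
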